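/- Let $\Gamma\subset\mathbb R^D$ ($D$ arbitrary, $\mathbb R^D$ with any norm, $\Gamma$ with the induced metric) be a lattice, i.e. a set whose distinct points have distance at least some fixed $\rho>0$ (for example $\mathbb Z^D$, or the vertex set of a graph embedded isometrically in $\mathbb R^D$). Attach $\mathbb C^d$ to each site, put $\mathcal H_\Lambda=\bigotimes_{x\in\Lambda}\mathbb C^d$ for finite $\Lambda\subset\Gamma$, and let $$H_\Lambda=\sum_{X\subset\Lambda}h(X),$$ where $h(X)$ acts on $\mathcal H_X$ and is identified with $h(X)\otimes 1_{\Lambda\setminus X}$. Assume that * (finite range) there is $r>0$ with $h(X)=0$ whenever $\operatorname{diam}X>r$; * (local projections) every $h(X)$ is an orthogonal projection, with lowest eigenvalue $0$; * (frustration freeness) $h(X)P_\Lambda=0$ for all finite $X\subset\Lambda$, where $P_\Lambda$ is the orthogonal projection onto the eigenspace of the lowest eigenvalue of $H_\Lambda$. Let $\lambda_\Lambda$ be the difference between the two lowest distinct eigenvalues of $H_\Lambda$ ($\lambda_\Lambda=+\infty$ if there is only one eigenvalue). Call $H$ gapped if $\inf_\Lambda\lambda_\Lambda>0$, the infimum being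 over all finite $\Lambda\subset\Gamma$, and gapless otherwise. For real $n$ let $$\lambda_n=\inf\{\lambda_\Lambda:\ \Lambda\subset\Gamma\text{ finite},\ \operatorname{diam}\Lambda\le n\}.$$ If $H$ is gapless, then for every $\varepsilon>0$, $\lambda_n$ is finite for all large $n$ and $$\lambda_n=o\!\left(\frac{\log(n)^{2+\varepsilon}}{n}\right)\qquad(n\to\infty).$$ -/

import Mathlib

open Filter Asymptotics
open scoped Matrix ENNReal

namespace SpinLattice

/-- Configurations of `d`-level systems on the finite region `Λ`. They label the standard product
basis of `⨂_{x ∈ Λ} ℂ^d`, which is therefore the space `Config d Λ → ℂ`. -/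
abbrev Config {Γ : Type*} (d : ℕ) (Λ : Finset Γ) : Type _ := Λ → Fin d

/-- The algebra of observables on `Λ`, i.e. the operators on `⨂_{x ∈ Λ} ℂ^d`, written as matrices
in the standard product basis. -/
abbrev Obs {Γ : Type*} (d : ℕ) (Λ : Finset Γ) : Type _ := Matrix (Config d Λ) (Config d Λ) ℂ

/-- The identification of an observable `A` on `X ⊆ Λ` with the observable `A ⊗ 1` on `Λ`: its
matrix element between `σ` and `τ` is that of `A` between the restrictions to `X` if `σ` and `τ`
coincide on `Λ \ X`, and is zero otherwise. -/
def extend {Γ : Type*} [DecidableEq Γ] {d : ℕ} {X Λ : Finset Γ} (hX : X ⊆ Λ) (A : Obs d X) :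
    Obs d Λ :=
  Matrix.of fun σ τ =>
    if ∀ x : Λ, (x : Γ) ∉ X → σ x = τ x then
      A (fun x => σ ⟨x, hX x.2⟩) (fun x => τ ⟨x, hX x.2⟩)
    else 0

/-- An interaction: a (Hermitian, see `IsAdmissible`) observable `h X` on every finite region. -/
abbrev Interaction (Γ : Type*) (d : ℕ) : Type _ := (X : Finset Γ) → Obs d X

/-- The local Hamiltonian `H_Λ = ∑_{X ⊆ Λ} h(X)`. -/
def hamiltonian {Γ : Type*} [DecidableEq Γ] {d : ℕ} (h : Interaction Γ d) (Λ : Finset Γ) :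
    Obs d Λ :=
  ∑ X ∈ Λ.powerset.attach, extend (Finset.mem_powerset.1 X.2) (h X.1)

/-- The set of (real) eigenvalues of an observable; for a Hermitian observable these are all the
eigenvalues. -/
def energies {Γ : Type*} [DecidableEq Γ] {d : ℕ} {Λ : Finset Γ} (A : Obs d Λ) : Set ℝ :=
  {E : ℝ | Module.End.HasEigenvalue (Matrix.toLin' A) (E : ℂ)}

/-- The lowest eigenvalue of an observable. -/
noncomputable def groundEnergy {Γ : Type*} [DecidableEq Γ] {d : ℕ} {Λ : Finset Γ}
    (A : Obs d Λ) : ℝ :=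
  sInf (energies A)

/-- The ground state space: the eigenspace of the lowest eigenvalue. -/
noncomputable def groundSpace {Γ : Type*} [DecidableEq Γ] {d : ℕ} {Λ : Finset Γ}
    (A : Obs d Λ) : Submodule ℂ (Config d Λ → ℂ) :=
  Module.End.eigenspace (Matrix.toLin' A) (groundEnergy A : ℂ)

/-- The standing assumptions on an interaction: finite range, local projections, lowest local
energies equal to zero, and frustration freeness. -/
structure IsAdmissible {Γ : Type*} [MetricSpace Γ] [DecidableEq Γ] {d : ℕ}
    (h : Interaction Γ d) : Prop where
  /-- The interaction vanishes on regions of diameter larger than some `r > 0`. -/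
  finite_range : ∃ r : ℝ, 0 < r ∧ ∀ X : Finset Γ, r < Metric.diam (X : Set Γ) → h X = 0
  /-- Every `h X` is an orthogonal projection. -/
  projection : ∀ X : Finset Γ, IsStarProjection (h X)
  /-- The lowest eigenvalue of every `h X` is zero. -/
  groundEnergy_eq_zero : ∀ X : Finset Γ, groundEnergy (h X) = 0
  /-- `h(X) P_Λ = E₀(X) P_Λ` for `X ⊆ Λ`, where `P_Λ` is the orthogonal projection onto the ground
  state space of `H_Λ`: on every ground state of `H_Λ`, `h(X)` acts as `E₀(X)`. -/
  frustration_free : ∀ (Λ X : Finset Γ) (hX : X ⊆ Λ), ∀ φ ∈ groundSpace (hamiltonian h Λ),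
    extend hX (h X) *ᵥ φ = (groundEnergy (h X) : ℂ) • φ

/-- The spectral gap `λ_Λ`: the difference between the two lowest distinct eigenvalues of `H_Λ`.
It is `∞` if there is just one eigenvalue (that is, the infimum of
`⟨φ, H_Λ φ⟩ / ⟨φ, P_Λ^⊥ φ⟩` over the empty set of `φ`). -/
noncomputable def spectralGap {Γ : Type*} [DecidableEq Γ] {d : ℕ} (h : Interaction Γ d)
    (Λ : Finset Γ) : ℝ≥0∞ :=
  ⨅ E ∈ energies (hamiltonian h Λ) \ {groundEnergy (hamiltonian h Λ)},
    ENNReal.ofReal (E - groundEnergy (hamiltonian h Λ))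

/-- `H` is gapped if the spectral gaps of all finite regions have a positive lower bound. -/
def IsGapped {Γ : Type*} [DecidableEq Γ] {d : ℕ} (h : Interaction Γ d) : Prop :=
  0 < ⨅ Λ : Finset Γ, spectralGap h Λ

/-- `H` is gapless if it is not gapped. -/
def IsGapless {Γ : Type*} [DecidableEq Γ] {d : ℕ} (h : Interaction Γ d) : Prop :=
  ¬ IsGapped h

/-- The spectral gap at length scale `n`: the infimum of `λ_Λ` over the finite regions `Λ` of
diameter at most `n`. -/
noncomputable def gapAtScale {Γ : Type*} [MetricSpace Γ] [DecidableEq Γ] {d : ℕ}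
    (h : Interaction Γ d) (n : ℝ) : ℝ≥0∞ :=
  ⨅ (Λ : Finset Γ) (_ : Metric.diam (Λ : Set Γ) ≤ n), spectralGap h Λ

end SpinLattice

/-! The proof gives the stronger bound `gapAtScale h n = O(1/n)`; any function tending to infinity
could replace the power of the logarithm. The engine is a finite-size criterion,
`IsAdmissible.gapAtLeast_of_gapInBoxes`: if all regions in boxes of one large side `L` have gap at
least `γ`, and `γ * L` exceeds a fixed constant, then every finite region has gap at least `γ / 2`.
In a gapless system this must fail at every large scale, so `γ` cannot exceed a multiple of `1 / n`.

To go from width `L` to `3L/2` in one direction, cover `Λ` by two overlapping parts of gap at least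
`γ`. If their ground spaces were orthogonal once the ground space of `H_Λ` is removed, the energies
of the parts would add up to at least `γ` on excited states. The defect `δ` is controlled by the
detectability lemma: an overlap with room for `2m` cuts gives `δ ≤ 1/(1 + m x/g²)`
(`norm_inner_le_of_cuts`), where `x` is the unknown gap of `Λ` itself and `g` bounds the number of
terms not commuting with a given one. Averaging over `s` pairs of parts with disjoint overlaps
counts each term at most `s + 1` times, so `s γ (1 - δ) ≤ (s + 1) x`. Since the bound on `1 - δ`
contains a factor `x`, this factor cancels and `x ≥ γ s/(s + 1) - g²/m` remains
(`IsAdmissible.gapAtLeast_of_parts`), with no a priori knowledge of `x`. Along the scales `L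
(3/2)^q`, with `s` and `m` growing suitably, the losses are summable. -/

namespace SpinLattice

/-! ### Detectability lemma and almost orthogonal subspaces in an abstract Hilbert space. -/

section Hilbert

variable {V : Type*} [NormedAddCommGroup V] [InnerProductSpace ℂ V] {κ : Type*}

/-- The ordered product of the complementary projections `1 - Q i` along a list. -/
noncomputable def complProd (Q : κ → V →ₗ[ℂ] V) (l : List κ) : Module.End ℂ V :=
  (l.map fun i => 1 - Q i).prod

theorem complProd_cons (Q : κ → V →ₗ[ℂ] V) (i : κ) (l : List κ) (ψ : V) :
    complProd Q (i :: l) ψ = complProd Q l ψ - Q i (complProd Q l ψ) := by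
  simp [complProd]

theorem complProd_append (Q : κ → V →ₗ[ℂ] V) (l l' : List κ) :
    complProd Q (l ++ l') = complProd Q l * complProd Q l' := by
  simp [complProd]

theorem complProd_commute {Q : κ → V →ₗ[ℂ] V} {l l' : List κ}
    (hc : ∀ i ∈ l, ∀ j ∈ l', Commute (Q i : Module.End ℂ V) (Q j)) :
    Commute (complProd Q l) (complProd Q l') := by
  refine Commute.list_prod_left _ _ fun a ha => Commute.list_prod_right _ _ fun b hb => ?_
  obtain ⟨i, hi, rfl⟩ := List.mem_map.1 ha
  obtain ⟨j, hj, rfl⟩ := List.mem_map.1 hb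
  exact (Commute.one_left _).sub_left ((Commute.one_right _).sub_right (hc i hi j hj))

theorem complProd_apply_of_forall {Q : κ → V →ₗ[ℂ] V} {l : List κ} {y : V}
    (hy : ∀ i ∈ l, Q i y = 0) : complProd Q l y = y := by
  induction l with
  | nil => simp [complProd]
  | cons i l ih =>
    rw [complProd_cons, ih fun j hj => hy j (List.mem_cons_of_mem _ hj), hy i List.mem_cons_self,
      sub_zero]

theorem inner_complProd_of_forall {Q : κ → V →ₗ[ℂ] V} (hs : ∀ i, (Q i).IsSymmetric)
    {l : List κ} {x : V} (hx : ∀ i ∈ l, Q i x = 0) (y : V) :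
    inner ℂ x (complProd Q l y) = inner ℂ x y := by
  induction l with
  | nil => simp [complProd]
  | cons i l ih =>
    rw [complProd_cons, inner_sub_right, ← hs i, hx i List.mem_cons_self, inner_zero_left,
      sub_zero, ih fun j hj => hx j (List.mem_cons_of_mem _ hj)]

/-- Pythagoras for a symmetric idempotent. -/
theorem norm_sub_apply_sq {T : V →ₗ[ℂ] V} (hs : T.IsSymmetric) (hi : ∀ v, T (T v) = T v) (v : V) :
    ‖v - T v‖ ^ 2 + ‖T v‖ ^ 2 = ‖v‖ ^ 2 := by
  have h0 : inner ℂ (v - T v) (T v) = 0 := by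
    rw [← hs, map_sub, hi, sub_self, inner_zero_left]
  have := norm_add_sq_eq_norm_sq_add_norm_sq_of_inner_eq_zero (𝕜 := ℂ) _ _ h0
  rw [sub_add_cancel] at this
  nlinarith

theorem norm_sub_apply_le {T : V →ₗ[ℂ] V} (hs : T.IsSymmetric) (hi : ∀ v, T (T v) = T v) (v : V) :
    ‖v - T v‖ ≤ ‖v‖ := by
  have := norm_sub_apply_sq hs hi v
  exact le_of_sq_le_sq (by nlinarith [sq_nonneg ‖T v‖]) (norm_nonneg _)

open Classical in
/-- The norm of the part removed by the projection `Q i` in the course of applying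
`complProd Q l` to `ψ`. -/
noncomputable def removed (Q : κ → V →ₗ[ℂ] V) (ψ : V) : List κ → κ → ℝ
  | [], _ => 0
  | j :: l, i => if i = j then ‖Q j (complProd Q l ψ)‖ else removed Q ψ l i

theorem removed_nonneg (Q : κ → V →ₗ[ℂ] V) (ψ : V) (l : List κ) (i : κ) :
    0 ≤ removed Q ψ l i := by
  induction l with
  | nil => simp [removed]
  | cons j l ih => unfold removed; split_ifs <;> simp [ih]

/-- Pythagoras at each factor makes the squared norms telescope. -/
theorem sum_removed_sq [DecidableEq κ] {Q : κ → V →ₗ[ℂ] V} (hs : ∀ i, (Q i).IsSymmetric)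
    (hi : ∀ i v, Q i (Q i v) = Q i v) (ψ : V) {l : List κ} (hl : l.Nodup) :
    ∑ i ∈ l.toFinset, removed Q ψ l i ^ 2 = ‖ψ‖ ^ 2 - ‖complProd Q l ψ‖ ^ 2 := by
  induction l with
  | nil => simp [complProd]
  | cons j l ih =>
    obtain ⟨hj, hl⟩ := List.nodup_cons.1 hl
    have hj' : j ∉ l.toFinset := by simpa using hj
    rw [List.toFinset_cons, Finset.sum_insert hj', complProd_cons]
    have : ∑ i ∈ l.toFinset, removed Q ψ (j :: l) i ^ 2 = ∑ i ∈ l.toFinset, removed Q ψ l i ^ 2 :=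
      Finset.sum_congr rfl fun i hi => by
        rw [removed, if_neg (by rintro rfl; exact hj' hi)]
    rw [this, ih hl, removed, if_pos rfl]
    linarith [norm_sub_apply_sq (hs j) (hi j) (complProd Q l ψ)]

-- Move `Q k` inwards from the outermost factor. It passes a commuting factor `1 - Q j`, which is a
-- contraction; a noncommuting one costs `‖Q j _‖`, the part removed there; on reaching its own
-- factor `1 - Q k` it gives zero.
open Classical in
theorem norm_apply_complProd_le {Q : κ → V →ₗ[ℂ] V} (hs : ∀ i, (Q i).IsSymmetric)
    (hi : ∀ i v, Q i (Q i v) = Q i v) (ψ : V) {l : List κ} (hl : l.Nodup) {k : κ} (hk : k ∈ l) :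
    ‖Q k (complProd Q l ψ)‖ ≤
      ∑ i ∈ l.toFinset with ¬ Commute (Q k : Module.End ℂ V) (Q i), removed Q ψ l i := by
  induction l with
  | nil => simp at hk
  | cons j l ih =>
    obtain ⟨hj, hl⟩ := List.nodup_cons.1 hl
    have hj' : j ∉ l.toFinset := by simpa using hj
    rw [complProd_cons, map_sub]
    by_cases hkj : k = j
    · subst hkj
      rw [hi, sub_self, norm_zero]
      exact Finset.sum_nonneg fun i _ => removed_nonneg _ _ _ _
    · have hk' : k ∈ l := by simpa [hkj] using hk
      have hsum : ∑ i ∈ l.toFinset with ¬ Commute (Q k : Module.End ℂ V) (Q i),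
          removed Q ψ (j :: l) i =
          ∑ i ∈ l.toFinset with ¬ Commute (Q k : Module.End ℂ V) (Q i), removed Q ψ l i :=
        Finset.sum_congr rfl fun i hi => by
          rw [removed, if_neg (by rintro rfl; exact hj' (Finset.mem_filter.1 hi).1)]
      rw [List.toFinset_cons, Finset.filter_insert]
      by_cases hc : Commute (Q k : Module.End ℂ V) (Q j)
      · rw [if_neg (by simpa using hc), hsum]
        refine le_trans ?_ (ih hl hk')
        have : Q k (Q j (complProd Q l ψ)) = Q j (Q k (complProd Q l ψ)) :=
          LinearMap.congr_fun hc.eq _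
        rw [this]
        exact norm_sub_apply_le (hs j) (hi j) _
      · rw [if_pos hc, Finset.sum_insert (by simp [hj]), hsum, removed, if_pos rfl]
        refine (norm_sub_le _ _).trans ?_
        rw [add_comm]
        refine add_le_add ?_ (ih hl hk')
        have := norm_sub_apply_sq (hs k) (hi k) (Q j (complProd Q l ψ))
        have hle : ‖Q k (Q j (complProd Q l ψ))‖ ^ 2 ≤ ‖Q j (complProd Q l ψ)‖ ^ 2 := by
          rw [← this]
          exact le_add_of_nonneg_left (sq_nonneg _)
        exact le_of_sq_le_sq hle (norm_nonneg _)

open Classical in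
/-- The energy estimate behind the detectability lemma. -/
theorem sum_norm_apply_complProd_sq_le {Q : κ → V →ₗ[ℂ] V} (hs : ∀ i, (Q i).IsSymmetric)
    (hi : ∀ i v, Q i (Q i v) = Q i v) {g : ℕ} {S : Finset κ}
    (hg : ∀ k ∈ S, (S.filter fun i => ¬ Commute (Q k : Module.End ℂ V) (Q i)).card ≤ g)
    {l : List κ} (hl : l.Nodup) (hlS : l.toFinset = S) (ψ : V) :
    ∑ k ∈ S, ‖Q k (complProd Q l ψ)‖ ^ 2 ≤ (g : ℝ) ^ 2 * (‖ψ‖ ^ 2 - ‖complProd Q l ψ‖ ^ 2) := by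
  subst hlS
  rw [← sum_removed_sq hs hi ψ hl]
  set S := l.toFinset
  have h1 : ∀ k ∈ S, ‖Q k (complProd Q l ψ)‖ ^ 2 ≤
      g * ∑ i ∈ S with ¬ Commute (Q k : Module.End ℂ V) (Q i), removed Q ψ l i ^ 2 := by
    intro k hk
    have hle := norm_apply_complProd_le hs hi ψ hl (List.mem_toFinset.1 hk)
    refine (pow_le_pow_left₀ (norm_nonneg _) hle 2).trans (sq_sum_le_card_mul_sum_sq.trans ?_)
    refine mul_le_mul_of_nonneg_right (by exact_mod_cast hg k hk) ?_
    exact Finset.sum_nonneg fun i _ => sq_nonneg _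
  refine (Finset.sum_le_sum h1).trans ?_
  rw [← Finset.mul_sum, sq, mul_assoc]
  refine mul_le_mul_of_nonneg_left ?_ (Nat.cast_nonneg _)
  -- Cauchy–Schwarz gave one factor `g`. Noncommutation is symmetric, so after exchanging the sums
  -- each removed part is counted at most `g` times, which gives the second.
  simp_rw [Finset.sum_filter]
  rw [Finset.sum_comm, Finset.mul_sum]
  refine Finset.sum_le_sum fun i hiS => ?_
  rw [← Finset.sum_filter, Finset.sum_const, nsmul_eq_mul]
  refine mul_le_mul_of_nonneg_right ?_ (sq_nonneg _)
  refine le_trans ?_ (Nat.cast_le.2 (hg i hiS))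
  refine Nat.cast_le.2 (Finset.card_le_card fun k hk => ?_)
  simp only [Finset.mem_filter] at hk ⊢
  exact ⟨hk.1, fun hc => hk.2 hc.symm⟩

/-- The common kernel of a family of operators. -/
noncomputable def commonKer (Q : κ → V →ₗ[ℂ] V) (S : Finset κ) : Submodule ℂ V :=
  ⨅ i ∈ S, LinearMap.ker (Q i)

theorem mem_commonKer {Q : κ → V →ₗ[ℂ] V} {S : Finset κ} {v : V} :
    v ∈ commonKer Q S ↔ ∀ i ∈ S, Q i v = 0 := by
  simp [commonKer]

theorem commonKer_anti (Q : κ → V →ₗ[ℂ] V) {S T : Finset κ} (hST : S ⊆ T) :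
    commonKer Q T ≤ commonKer Q S := fun _ hv =>
  mem_commonKer.2 fun i hi => mem_commonKer.1 hv i (hST hi)

theorem complProd_mem_orthogonal {Q : κ → V →ₗ[ℂ] V} (hs : ∀ i, (Q i).IsSymmetric)
    {S : Finset κ} {l : List κ} (hl : ∀ i ∈ l, i ∈ S) {ψ : V} (hψ : ψ ∈ (commonKer Q S)ᗮ) :
    complProd Q l ψ ∈ (commonKer Q S)ᗮ := by
  intro φ hφ
  rw [inner_complProd_of_forall hs fun i hi => mem_commonKer.1 hφ i (hl i hi)]
  exact hψ φ hφ

open Classical in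
/-- The detectability lemma. -/
theorem norm_complProd_sq_le {Q : κ → V →ₗ[ℂ] V} (hs : ∀ i, (Q i).IsSymmetric)
    (hi : ∀ i v, Q i (Q i v) = Q i v) {g : ℕ} (hg0 : 0 < g) {S : Finset κ}
    (hg : ∀ k ∈ S, (S.filter fun i => ¬ Commute (Q k : Module.End ℂ V) (Q i)).card ≤ g)
    {γ : ℝ} (hγ : ∀ ψ ∈ (commonKer Q S)ᗮ, γ * ‖ψ‖ ^ 2 ≤ ∑ k ∈ S, ‖Q k ψ‖ ^ 2)
    {l : List κ} (hl : l.Nodup) (hlS : l.toFinset = S) {ψ : V} (hψ : ψ ∈ (commonKer Q S)ᗮ) :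
    (1 + γ / (g : ℝ) ^ 2) * ‖complProd Q l ψ‖ ^ 2 ≤ ‖ψ‖ ^ 2 := by
  have h1 := sum_norm_apply_complProd_sq_le hs hi hg hl hlS ψ
  have h2 := hγ _ (complProd_mem_orthogonal hs (fun i hi => by simpa [← hlS] using hi) hψ)
  have hg' : (0 : ℝ) < (g : ℝ) ^ 2 := by positivity
  have h3 : γ / (g : ℝ) ^ 2 * ‖complProd Q l ψ‖ ^ 2 ≤ ‖ψ‖ ^ 2 - ‖complProd Q l ψ‖ ^ 2 := by
    rw [div_mul_eq_mul_div, div_le_iff₀ hg', mul_comm (_ - _)]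
    exact h2.trans h1
  linarith

/-- Two closed subspaces whose vectors are almost orthogonal once the common part `G` has been
removed. -/
theorem sub_mul_norm_sq_le_of_almost_orthogonal {G KA KB : Submodule ℂ V}
    [KA.HasOrthogonalProjection] [KB.HasOrthogonalProjection] (hB : G ≤ KB)
    {δ : ℝ} (hδ0 : 0 ≤ δ)
    (hδ : ∀ x ∈ KA, ∀ y ∈ KB, y ∈ Gᗮ → ‖inner ℂ x y‖ ≤ δ * ‖x‖ * ‖y‖)
    {ψ : V} (hψ : ψ ∈ Gᗮ) :
    (1 - δ) * ‖ψ‖ ^ 2 ≤ ‖ψ - KA.starProjection ψ‖ ^ 2 + ‖ψ - KB.starProjection ψ‖ ^ 2 := by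
  have pyth : ∀ (K : Submodule ℂ V) [K.HasOrthogonalProjection],
      ‖ψ - K.starProjection ψ‖ ^ 2 + ‖K.starProjection ψ‖ ^ 2 = ‖ψ‖ ^ 2 := fun K _ =>
    norm_sub_apply_sq (T := K.starProjection.toLinearMap)
      (Submodule.starProjection_isSymmetric K)
      (fun _ => Submodule.starProjection_eq_self_iff.2 (Submodule.starProjection_apply_mem _ _)) ψ
  have hself : ∀ (K : Submodule ℂ V) [K.HasOrthogonalProjection],
      inner ℂ ψ (K.starProjection ψ) = ((‖K.starProjection ψ‖ ^ 2 : ℝ) : ℂ) := fun K _ => by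
    have h := Submodule.starProjection_isSymmetric K ψ (K.starProjection ψ)
    have h2 : K.starProjection (K.starProjection ψ) = K.starProjection ψ :=
      Submodule.starProjection_eq_self_iff.2 (Submodule.starProjection_apply_mem _ _)
    simp only [ContinuousLinearMap.coe_coe] at h
    rw [h2] at h
    rw [← h, inner_self_eq_norm_sq_to_K]
    norm_cast
  set x := KA.starProjection ψ with hx
  set y := KB.starProjection ψ with hy
  have hyG : y ∈ Gᗮ := by
    intro φ hφ
    have h := Submodule.starProjection_isSymmetric KB φ ψ
    simp only [ContinuousLinearMap.coe_coe] at h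
    rw [Submodule.starProjection_eq_self_iff.2 (hB hφ)] at h
    rw [hy, ← h]
    exact hψ φ hφ
  have hxy := hδ x (Submodule.starProjection_apply_mem _ _) y
    (Submodule.starProjection_apply_mem _ _) hyG
  have h1 := pyth KA
  have h2 := pyth KB
  rw [← hx] at h1
  rw [← hy] at h2
  -- The left side is `⟨ψ, x + y⟩`, so this is Cauchy–Schwarz. Combined with `h4`, and after
  -- division by `‖x‖² + ‖y‖²`, it yields `h6`; two Pythagoras identities then finish.
  have h3 : ‖x‖ ^ 2 + ‖y‖ ^ 2 ≤ ‖ψ‖ * ‖x + y‖ := by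
    have h := norm_inner_le_norm (𝕜 := ℂ) ψ (x + y)
    rw [inner_add_right, hx, hy, hself KA, hself KB, ← Complex.ofReal_add, Complex.norm_real,
      Real.norm_of_nonneg (by positivity)] at h
    exact h
  have h4 : ‖x + y‖ ^ 2 ≤ (1 + δ) * (‖x‖ ^ 2 + ‖y‖ ^ 2) := by
    rw [norm_add_sq (𝕜 := ℂ)]
    have h5 : RCLike.re (inner ℂ x y) ≤ δ * ‖x‖ * ‖y‖ := (RCLike.re_le_norm _).trans hxy
    nlinarith [mul_nonneg hδ0 (sq_nonneg (‖x‖ - ‖y‖))]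
  have h6 : ‖x‖ ^ 2 + ‖y‖ ^ 2 ≤ (1 + δ) * ‖ψ‖ ^ 2 := by
    set t := ‖x‖ ^ 2 + ‖y‖ ^ 2
    have ht : 0 ≤ t := by positivity
    have h7 : t ^ 2 ≤ ‖ψ‖ ^ 2 * ((1 + δ) * t) :=
      (pow_le_pow_left₀ ht h3 2).trans (by
        rw [mul_pow]; exact mul_le_mul_of_nonneg_left h4 (sq_nonneg _))
    rcases ht.eq_or_lt with h0 | h0
    · rw [← h0]; positivity
    · nlinarith
  linarith

/-- Two families of operators whose members commute in the relevant order can be separated in an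
alternating product. -/
theorem prod_range_mul_of_commute {M : Type*} [Monoid M] (a b : ℕ → M) (q : ℕ)
    (hc : ∀ s t, s < t → t < q → Commute (b s) (a t)) :
    ((List.range q).map fun t => a t * b t).prod =
      ((List.range q).map a).prod * ((List.range q).map b).prod := by
  induction q with
  | zero => simp
  | succ q ih =>
    have hcomm : Commute ((List.range q).map b).prod (a q) := by
      refine Commute.list_prod_left _ _ fun c hc' => ?_
      obtain ⟨s, hs, rfl⟩ := List.mem_map.1 hc'
      exact hc s q (List.mem_range.1 hs) q.lt_succ_self
    rw [List.prod_range_succ, ih fun s t hst ht => hc s t hst (ht.trans q.lt_succ_self),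
      List.prod_range_succ, List.prod_range_succ, mul_assoc, ← mul_assoc _ (a q) (b q), hcomm.eq,
      mul_assoc, mul_assoc]

open Classical in
/-- Vectors in the common kernels of two overlapping families `SA`, `SB` of projections are almost
orthogonal, if they are orthogonal to the common kernel of all projections and if there are `2 * m`
successive ways to cut the family `S` into parts of `SA` and `SB`. -/
theorem norm_inner_le_of_cuts {Q : κ → V →ₗ[ℂ] V} (hs : ∀ i, (Q i).IsSymmetric)
    (hi : ∀ i v, Q i (Q i v) = Q i v) {g : ℕ} (hg0 : 0 < g) {S SA SB : Finset κ}
    (hg : ∀ k ∈ S, (S.filter fun i => ¬ Commute (Q k : Module.End ℂ V) (Q i)).card ≤ g)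
    {γ : ℝ} (hγ0 : 0 ≤ γ) (hγ : ∀ ψ ∈ (commonKer Q S)ᗮ, γ * ‖ψ‖ ^ 2 ≤ ∑ k ∈ S, ‖Q k ψ‖ ^ 2)
    {m : ℕ} (left : ℕ → κ → Prop)
    (hA : ∀ t < 2 * m, ∀ i ∈ S, left t i → i ∈ SA)
    (hB : ∀ t < 2 * m, ∀ i ∈ S, ¬ left t i → i ∈ SB)
    (hc : ∀ s t, s < t → t < 2 * m → ∀ i ∈ S, ∀ j ∈ S, ¬ left s i → left t j →
      Commute (Q i : Module.End ℂ V) (Q j))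
    {x y : V} (hx : x ∈ commonKer Q SA) (hy : y ∈ commonKer Q SB)
    (hyG : y ∈ (commonKer Q S)ᗮ) :
    ‖inner ℂ x y‖ ≤ 1 / (1 + m * (γ / (g : ℝ) ^ 2)) * ‖x‖ * ‖y‖ := by
  set lA : ℕ → List κ := fun t => (S.filter (left t)).toList with hlA
  set lB : ℕ → List κ := fun t => (S.filter fun i => ¬ left t i).toList with hlB
  -- `W (2 * m)` is evaluated in two ways. Each factor is a detectability product over all of `S`,
  -- so it contracts. But the factors can also be sorted into all `lA` before all `lB`; the former
  -- fix `x` from the left and the latter fix `y`, so `⟨x, W y⟩ = ⟨x, y⟩`.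
  set W : ℕ → Module.End ℂ V := fun q =>
    ((List.range q).map fun t => complProd Q (lA t) * complProd Q (lB t)).prod with hW
  set β := 1 + γ / (g : ℝ) ^ 2 with hβ
  have hβ0 : 0 ≤ γ / (g : ℝ) ^ 2 := by positivity
  have hcontr : ∀ t, ∀ ψ ∈ (commonKer Q S)ᗮ,
      complProd Q (lA t) (complProd Q (lB t) ψ) ∈ (commonKer Q S)ᗮ ∧
      β * ‖complProd Q (lA t) (complProd Q (lB t) ψ)‖ ^ 2 ≤ ‖ψ‖ ^ 2 := by
    intro t ψ hψ
    have hnd : (lA t ++ lB t).Nodup := by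
      refine List.Nodup.append (Finset.nodup_toList _) (Finset.nodup_toList _) fun i h1 h2 => ?_
      simp only [hlA, hlB, Finset.mem_toList, Finset.mem_filter] at h1 h2
      exact h2.2 h1.2
    have hS : (lA t ++ lB t).toFinset = S := by
      rw [List.toFinset_append, Finset.toList_toFinset, Finset.toList_toFinset,
        Finset.filter_union_filter_not_eq]
    have h := norm_complProd_sq_le hs hi hg0 hg hγ hnd hS hψ
    have h' := complProd_mem_orthogonal hs (S := S) (l := lA t ++ lB t)
      (fun i hi => by rw [← hS]; simpa using hi) hψ
    rw [complProd_append] at h h'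
    exact ⟨h', h⟩
  have hWn : ∀ q, ∀ ψ ∈ (commonKer Q S)ᗮ, β ^ q * ‖W q ψ‖ ^ 2 ≤ ‖ψ‖ ^ 2 := by
    intro q
    induction q with
    | zero => intro ψ _; simp [hW]
    | succ q ih =>
      intro ψ hψ
      obtain ⟨h1, h2⟩ := hcontr q ψ hψ
      have h3 := ih _ h1
      have h4 : W (q + 1) ψ = W q (complProd Q (lA q) (complProd Q (lB q) ψ)) := by
        simp only [hW, List.prod_range_succ, Module.End.mul_apply]
      rw [h4, pow_succ]
      have hβ1 : 0 ≤ β := by positivity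
      nlinarith
  have hWprod : W (2 * m) = ((List.range (2 * m)).map fun t => complProd Q (lA t)).prod *
      ((List.range (2 * m)).map fun t => complProd Q (lB t)).prod := by
    refine prod_range_mul_of_commute _ _ _ fun s t hst ht => complProd_commute fun i hi j hj => ?_
    simp only [hlA, hlB, Finset.mem_toList, Finset.mem_filter] at hi hj
    exact hc s t hst ht i hi.1 j hj.1 hi.2 hj.2
  have hfixB : ((List.range (2 * m)).map fun t => complProd Q (lB t)).prod y = y := by
    have : ∀ L : List ℕ, (∀ t ∈ L, t < 2 * m) →
        (L.map fun t => complProd Q (lB t)).prod y = y := by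
      intro L
      induction L with
      | nil => simp
      | cons t L ih =>
        intro hL
        rw [List.map_cons, List.prod_cons, Module.End.mul_apply,
          ih fun u hu => hL u (List.mem_cons_of_mem _ hu)]
        refine complProd_apply_of_forall fun i hi => ?_
        simp only [hlB, Finset.mem_toList, Finset.mem_filter] at hi
        exact mem_commonKer.1 hy i (hB t (hL t List.mem_cons_self) i hi.1 hi.2)
    exact this _ fun t ht => List.mem_range.1 ht
  have hfixA : ∀ z, inner ℂ x (((List.range (2 * m)).map fun t => complProd Q (lA t)).prod z) =
      inner ℂ x z := by
    have : ∀ L : List ℕ, (∀ t ∈ L, t < 2 * m) → ∀ z,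
        inner ℂ x ((L.map fun t => complProd Q (lA t)).prod z) = inner ℂ x z := by
      intro L
      induction L with
      | nil => simp
      | cons t L ih =>
        intro hL z
        rw [List.map_cons, List.prod_cons, Module.End.mul_apply, inner_complProd_of_forall hs,
          ih fun u hu => hL u (List.mem_cons_of_mem _ hu)]
        intro i hi
        simp only [hlA, Finset.mem_toList, Finset.mem_filter] at hi
        exact mem_commonKer.1 hx i (hA t (hL t List.mem_cons_self) i hi.1 hi.2)
    exact this _ fun t ht => List.mem_range.1 ht
  have hWy : inner ℂ x (W (2 * m) y) = inner ℂ x y := by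
    rw [hWprod, Module.End.mul_apply, hfixB, hfixA]
  -- Detectability contracts squared norms by `β`, so `2 * m` factors contract the norm by `β ^ m`.
  have hn : β ^ m * ‖W (2 * m) y‖ ≤ ‖y‖ := by
    have h := hWn (2 * m) y hyG
    refine le_of_sq_le_sq ?_ (norm_nonneg _)
    rwa [mul_pow, ← pow_mul, mul_comm m 2]
  have hbern : 1 + m * (γ / (g : ℝ) ^ 2) ≤ β ^ m := one_add_mul_le_pow (by linarith) m
  have hpos : 0 < 1 + m * (γ / (g : ℝ) ^ 2) := by positivity
  rw [← hWy]
  refine (norm_inner_le_norm _ _).trans ?_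
  have h5 : ‖W (2 * m) y‖ ≤ 1 / (1 + m * (γ / (g : ℝ) ^ 2)) * ‖y‖ := by
    rw [one_div_mul_eq_div, le_div_iff₀ hpos, mul_comm]
    exact (mul_le_mul_of_nonneg_right hbern (norm_nonneg _)).trans hn
  calc ‖x‖ * ‖W (2 * m) y‖ ≤ ‖x‖ * (1 / (1 + m * (γ / (g : ℝ) ^ 2)) * ‖y‖) :=
        mul_le_mul_of_nonneg_left h5 (norm_nonneg _)
    _ = _ := by ring

/-- A symmetric operator whose eigenvalues are `0` or at least `γ` is bounded below by `γ` on the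
orthogonal complement of its kernel. -/
theorem mul_norm_sq_le_inner_of_eigenvalues [FiniteDimensional ℂ V] {T : V →ₗ[ℂ] V}
    (hT : T.IsSymmetric) {γ : ℝ}
    (hγ : ∀ E : ℝ, Module.End.HasEigenvalue T (E : ℂ) → E = 0 ∨ γ ≤ E) {ψ : V}
    (hψ : ψ ∈ (LinearMap.ker T)ᗮ) : γ * ‖ψ‖ ^ 2 ≤ RCLike.re (inner ℂ ψ (T ψ)) := by
  set b := hT.eigenvectorBasis rfl with hb
  have hTb : ∀ i, T (b i) = (hT.eigenvalues rfl i : ℂ) • b i := fun i =>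
    hT.apply_eigenvectorBasis rfl i
  have h1 : inner ℂ ψ (T ψ) = ∑ i, ((hT.eigenvalues rfl i * ‖inner ℂ (b i) ψ‖ ^ 2 : ℝ) : ℂ) := by
    rw [← b.sum_inner_mul_inner ψ (T ψ)]
    refine Finset.sum_congr rfl fun i _ => ?_
    rw [← hT, hTb, inner_smul_left, Complex.conj_ofReal, ← inner_conj_symm ψ (b i)]
    rw [mul_left_comm, RCLike.conj_mul]
    push_cast
    rfl
  rw [h1, ← Complex.ofReal_sum, ← b.sum_sq_norm_inner_right ψ, Finset.mul_sum]
  rw [RCLike.re_eq_complex_re, Complex.ofReal_re]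
  refine Finset.sum_le_sum fun i _ => ?_
  rcases hγ (hT.eigenvalues rfl i) (hT.hasEigenvalue_eigenvalues rfl i) with h0 | h0
  · have : inner ℂ (b i) ψ = 0 := hψ _ (by rw [LinearMap.mem_ker, hTb, h0]; simp)
    simp [this]
  · exact mul_le_mul_of_nonneg_right h0 (sq_nonneg _)

end Hilbert

/-! ### Local terms as operators on a region, and spectra of subregions. -/

section Observables

variable {Γ : Type*} [DecidableEq Γ] {d : ℕ}

/-- The configuration on `Λ` that is `α` on `X` and `σ` elsewhere. -/
def glue {X Λ : Finset Γ} (σ : Config d Λ) (α : Config d X) : Config d Λ := fun x =>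
  if hx : (x : Γ) ∈ X then α ⟨x, hx⟩ else σ x

/-- The restriction of a configuration to a smaller region. -/
def restrictTo {X Λ : Finset Γ} (hX : X ⊆ Λ) (σ : Config d Λ) : Config d X := fun x =>
  σ ⟨x, hX x.2⟩

theorem restrictTo_glue {X Λ : Finset Γ} (hX : X ⊆ Λ) (σ : Config d Λ) (α : Config d X) :
    restrictTo hX (glue σ α) = α := by
  funext x
  simp [restrictTo, glue]

theorem glue_glue {X Λ : Finset Γ} (σ : Config d Λ) (α β : Config d X) :
    glue (glue σ α) β = glue σ β := by
  funext x
  simp only [glue]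
  split_ifs <;> rfl

theorem glue_restrictTo {X Λ : Finset Γ} (hX : X ⊆ Λ) (σ : Config d Λ) :
    glue σ (restrictTo hX σ) = σ := by
  funext x
  simp [glue, restrictTo]

theorem extend_mulVec_apply {X Λ : Finset Γ} (hX : X ⊆ Λ) (A : Obs d X) (ψ : Config d Λ → ℂ)
    (σ : Config d Λ) :
    (extend hX A *ᵥ ψ) σ = ∑ α, A (restrictTo hX σ) α * ψ (glue σ α) := by
  symm
  refine Fintype.sum_of_injective (fun α => glue σ α) (fun α β hαβ => ?_) _ _
    (fun τ hτ => ?_) (fun α => ?_)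
  · rw [← restrictTo_glue hX σ α, ← restrictTo_glue hX σ β]
    exact congrArg _ hαβ
  · change extend hX A σ τ * _ = _
    rw [extend, Matrix.of_apply, if_neg, zero_mul]
    intro hστ
    refine hτ ⟨restrictTo hX τ, ?_⟩
    funext x
    by_cases hx : (x : Γ) ∈ X
    · simp [glue, hx, restrictTo]
    · simp [glue, hx, hστ x hx]
  · change _ = extend hX A σ (glue σ α) * _
    rw [extend, Matrix.of_apply, if_pos fun x hx => by simp [glue, hx]]
    congr 2
    exact (restrictTo_glue hX σ α).symm

theorem extend_mulVec_extend_mulVec {X Λ : Finset Γ} (hX : X ⊆ Λ) (A B : Obs d X)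
    (ψ : Config d Λ → ℂ) : extend hX A *ᵥ (extend hX B *ᵥ ψ) = extend hX (A * B) *ᵥ ψ := by
  funext σ
  simp only [extend_mulVec_apply, restrictTo_glue, glue_glue, Matrix.mul_apply, Finset.mul_sum,
    Finset.sum_mul]
  rw [Finset.sum_comm]
  exact Finset.sum_congr rfl fun β _ => Finset.sum_congr rfl fun α _ => by ring

theorem extend_mulVec_comm {X Y Λ : Finset Γ} (hX : X ⊆ Λ) (hY : Y ⊆ Λ) (hXY : Disjoint X Y)
    (A : Obs d X) (B : Obs d Y) (ψ : Config d Λ → ℂ) :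
    extend hX A *ᵥ (extend hY B *ᵥ ψ) = extend hY B *ᵥ (extend hX A *ᵥ ψ) := by
  have hXY' : ∀ x ∈ X, x ∉ Y := fun x hx hy => Finset.disjoint_left.1 hXY hx hy
  funext σ
  simp only [extend_mulVec_apply, Finset.mul_sum]
  rw [Finset.sum_comm]
  refine Finset.sum_congr rfl fun β _ => Finset.sum_congr rfl fun α _ => ?_
  have h1 : restrictTo hY (glue σ α) = restrictTo hY σ := by
    funext x
    have : (x : Γ) ∉ X := fun hx => hXY' _ hx x.2
    simp [restrictTo, glue, this]
  have h2 : restrictTo hX (glue σ β) = restrictTo hX σ := by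
    funext x
    simp [restrictTo, glue, hXY' _ x.2]
  have h3 : glue (glue σ α) β = glue (glue σ β) α := by
    funext x
    by_cases hx : (x : Γ) ∈ X
    · simp [glue, hx, hXY' _ hx]
    · simp [glue, hx]
  rw [h1, h2, h3]
  ring

theorem extend_isHermitian {X Λ : Finset Γ} (hX : X ⊆ Λ) {A : Obs d X} (hA : A.IsHermitian) :
    (extend hX A).IsHermitian := by
  ext σ τ
  rw [Matrix.conjTranspose_apply, extend, Matrix.of_apply, Matrix.of_apply]
  by_cases hc : ∀ x : Λ, (x : Γ) ∉ X → σ x = τ x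
  · rw [if_pos hc, if_pos fun x hx => (hc x hx).symm]
    exact hA.apply _ _
  · rw [if_neg hc, if_neg fun hc' => hc fun x hx => (hc' x hx).symm, star_zero]

/-- The interaction term `h X` as an operator on the Hilbert space of the region `Λ`. -/
noncomputable def localTerm (h : Interaction Γ d) (Λ X : Finset Γ) :
    EuclideanSpace ℂ (Config d Λ) →ₗ[ℂ] EuclideanSpace ℂ (Config d Λ) :=
  if hX : X ⊆ Λ then Matrix.toEuclideanLin (extend hX (h X)) else 0

theorem ofLp_localTerm {h : Interaction Γ d} {Λ X : Finset Γ} (hX : X ⊆ Λ)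
    (ψ : EuclideanSpace ℂ (Config d Λ)) :
    (localTerm h Λ X ψ).ofLp = extend hX (h X) *ᵥ ψ.ofLp := by
  rw [localTerm, dif_pos hX]
  rfl

theorem localTerm_of_not_subset {h : Interaction Γ d} {Λ X : Finset Γ} (hX : ¬ X ⊆ Λ) :
    localTerm h Λ X = 0 := by
  rw [localTerm, dif_neg hX]

theorem localTerm_eq_zero {h : Interaction Γ d} {Λ X : Finset Γ} (h0 : h X = 0) :
    localTerm h Λ X = 0 := by
  rw [localTerm]
  split_ifs with hX
  · have : extend hX (h X) = 0 := by
      ext σ τ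
      simp [extend, h0]
    rw [this, map_zero]
  · rfl

theorem localTerm_isSymmetric {h : Interaction Γ d} (hp : ∀ X, IsStarProjection (h X))
    (Λ X : Finset Γ) : (localTerm h Λ X).IsSymmetric := by
  rw [localTerm]
  split_ifs with hX
  · exact Matrix.isSymmetric_toEuclideanLin_iff.2 (extend_isHermitian hX (hp X).isSelfAdjoint)
  · exact LinearMap.IsSymmetric.zero

theorem localTerm_localTerm {h : Interaction Γ d} (hp : ∀ X, IsStarProjection (h X))
    (Λ X : Finset Γ) (ψ : EuclideanSpace ℂ (Config d Λ)) :
    localTerm h Λ X (localTerm h Λ X ψ) = localTerm h Λ X ψ := by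
  by_cases hX : X ⊆ Λ
  · apply WithLp.ofLp_injective
    rw [ofLp_localTerm hX, ofLp_localTerm hX, extend_mulVec_extend_mulVec,
      (hp X).isIdempotentElem.eq]
  · simp [localTerm_of_not_subset hX]

theorem localTerm_commute (h : Interaction Γ d) (Λ : Finset Γ) {X Y : Finset Γ}
    (hXY : Disjoint X Y) :
    Commute (localTerm h Λ X : Module.End ℂ (EuclideanSpace ℂ (Config d Λ)))
      (localTerm h Λ Y) := by
  by_cases hX : X ⊆ Λ
  · by_cases hY : Y ⊆ Λ
    · refine LinearMap.ext fun ψ => WithLp.ofLp_injective 2 ?_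
      rw [Module.End.mul_apply, Module.End.mul_apply, ofLp_localTerm hX, ofLp_localTerm hY,
        ofLp_localTerm hY, ofLp_localTerm hX, extend_mulVec_comm hX hY hXY]
    · rw [localTerm_of_not_subset hY]
      exact Commute.zero_right _
  · rw [localTerm_of_not_subset hX]
    exact Commute.zero_left _

open Classical in
/-- The regions inside `Λ` that carry a nonzero interaction term. -/
noncomputable def terms (h : Interaction Γ d) (Λ : Finset Γ) : Finset (Finset Γ) :=
  Λ.powerset.filter fun X => h X ≠ 0

theorem mem_terms {h : Interaction Γ d} {Λ X : Finset Γ} :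
    X ∈ terms h Λ ↔ X ⊆ Λ ∧ h X ≠ 0 := by
  simp [terms]

theorem terms_mono (h : Interaction Γ d) {A Λ : Finset Γ} (hA : A ⊆ Λ) :
    terms h A ⊆ terms h Λ := fun _ hX =>
  mem_terms.2 ⟨(mem_terms.1 hX).1.trans hA, (mem_terms.1 hX).2⟩

/-- The eigenvalues of the Hamiltonian of `Λ` are `0` or at least `γ`. -/
def GapAtLeast (h : Interaction Γ d) (γ : ℝ) (Λ : Finset Γ) : Prop :=
  ∀ E ∈ energies (hamiltonian h Λ), E = 0 ∨ γ ≤ E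

theorem GapAtLeast.mono {h : Interaction Γ d} {γ γ' : ℝ} {Λ : Finset Γ} (hγ : GapAtLeast h γ Λ)
    (hle : γ' ≤ γ) : GapAtLeast h γ' Λ := fun E hE => (hγ E hE).imp_right hle.trans

theorem hamiltonian_mulVec (h : Interaction Γ d) (Λ : Finset Γ) (v : Config d Λ → ℂ) :
    hamiltonian h Λ *ᵥ v =
      ∑ X ∈ Λ.powerset.attach, extend (Finset.mem_powerset.1 X.2) (h X.1) *ᵥ v := by
  rw [hamiltonian, Matrix.sum_mulVec]

theorem mem_energies_iff {Λ : Finset Γ} {A : Obs d Λ} {E : ℝ} :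
    E ∈ energies A ↔ ∃ v : Config d Λ → ℂ, v ≠ 0 ∧ A *ᵥ v = (E : ℂ) • v := by
  constructor
  · intro hE
    obtain ⟨v, hv⟩ := Module.End.HasEigenvalue.exists_hasEigenvector hE
    exact ⟨v, hv.2, by simpa using hv.apply_eq_smul⟩
  · rintro ⟨v, hv, hE⟩
    exact Module.End.hasEigenvalue_of_hasEigenvector
      ⟨Module.End.mem_eigenspace_iff.2 (by simpa using hE), hv⟩

theorem sum_terms_localTerm (h : Interaction Γ d) (A Λ : Finset Γ) :
    ∑ X ∈ terms h A, localTerm h Λ X = ∑ X ∈ A.powerset, localTerm h Λ X := by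
  classical
  refine Finset.sum_filter_of_ne fun X _ hX h0 => hX (localTerm_eq_zero h0)

/-- Terms inside `A` do not touch the spins outside `A`, so these can be frozen at their values in
`σ`. -/
theorem ofLp_sum_localTerm_glue (h : Interaction Γ d) {A Λ : Finset Γ} (hA : A ⊆ Λ)
    (φ : EuclideanSpace ℂ (Config d Λ)) (σ : Config d Λ) (α : Config d A) :
    ((∑ X ∈ terms h A, localTerm h Λ X) φ).ofLp (glue σ α) =
      (hamiltonian h A *ᵥ fun β => φ.ofLp (glue σ β)) α := by
  rw [sum_terms_localTerm, hamiltonian_mulVec, LinearMap.sum_apply, WithLp.ofLp_sum,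
    ← Finset.sum_attach, Finset.sum_apply, Finset.sum_apply]
  refine Finset.sum_congr rfl fun X _ => ?_
  have hX : X.1 ⊆ A := Finset.mem_powerset.1 X.2
  rw [ofLp_localTerm (hX.trans hA), extend_mulVec_apply, extend_mulVec_apply]
  refine Finset.sum_congr rfl fun β _ => ?_
  have h1 : restrictTo (hX.trans hA) (glue σ α) = restrictTo hX α := by
    funext x
    simp [restrictTo, glue, hX x.2]
  have h2 : glue (glue σ α) β = glue σ (glue α β) := by
    funext x
    by_cases hx : (x : Γ) ∈ X.1
    · simp [glue, hx, hX hx]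
    · simp [glue, hx]
  rw [h1, h2]

/-- Tensoring with the identity creates no new eigenvalues: a nonzero slice of an eigenvector, with
the outside spins frozen, is an eigenvector on `A`. -/
theorem mem_energies_of_hasEigenvalue (h : Interaction Γ d) {A Λ : Finset Γ} (hA : A ⊆ Λ) {E : ℝ}
    (hE : Module.End.HasEigenvalue (∑ X ∈ terms h A, localTerm h Λ X) (E : ℂ)) :
    E ∈ energies (hamiltonian h A) := by
  obtain ⟨φ, hφ, hφ0⟩ := hE.exists_hasEigenvector
  rw [Module.End.mem_eigenspace_iff] at hφ
  obtain ⟨σ, hσ⟩ : ∃ σ, φ.ofLp σ ≠ 0 := by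
    by_contra! hcon
    exact hφ0 (WithLp.ofLp_injective 2 (funext hcon))
  refine mem_energies_iff.2 ⟨fun β => φ.ofLp (glue σ β), fun h0 => hσ ?_, ?_⟩
  · rw [← glue_restrictTo hA σ]
    exact congrFun h0 _
  · funext α
    rw [← ofLp_sum_localTerm_glue h hA, hφ]
    rfl

theorem re_inner_sum_localTerm {h : Interaction Γ d} (hp : ∀ X, IsStarProjection (h X))
    (S : Finset (Finset Γ)) (Λ : Finset Γ) (ψ : EuclideanSpace ℂ (Config d Λ)) :
    RCLike.re (inner ℂ ψ ((∑ X ∈ S, localTerm h Λ X) ψ)) =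
      ∑ X ∈ S, ‖localTerm h Λ X ψ‖ ^ 2 := by
  rw [LinearMap.sum_apply, inner_sum, map_sum]
  refine Finset.sum_congr rfl fun X _ => ?_
  rw [← localTerm_localTerm hp, ← localTerm_isSymmetric hp, inner_self_eq_norm_sq,
    localTerm_localTerm hp]

theorem ker_sum_localTerm {h : Interaction Γ d} (hp : ∀ X, IsStarProjection (h X))
    (S : Finset (Finset Γ)) (Λ : Finset Γ) :
    LinearMap.ker (∑ X ∈ S, localTerm h Λ X) = commonKer (localTerm h Λ) S := by
  ext ψ
  rw [mem_commonKer, LinearMap.mem_ker]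
  constructor
  · intro h0 X hX
    have h1 := re_inner_sum_localTerm hp S Λ ψ
    rw [h0, inner_zero_right, map_zero] at h1
    have h2 := (Finset.sum_eq_zero_iff_of_nonneg fun X _ => sq_nonneg _).1 h1.symm X hX
    simpa using h2
  · intro h0
    rw [LinearMap.sum_apply]
    exact Finset.sum_eq_zero h0

/-- A lower bound on the gap of `A` gives a lower bound on the energy in any larger region. -/
theorem GapAtLeast.mul_norm_sq_le {h : Interaction Γ d} (hp : ∀ X, IsStarProjection (h X))
    {γ : ℝ} {A Λ : Finset Γ} (hA : A ⊆ Λ) (hγ : GapAtLeast h γ A)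
    {ψ : EuclideanSpace ℂ (Config d Λ)} (hψ : ψ ∈ (commonKer (localTerm h Λ) (terms h A))ᗮ) :
    γ * ‖ψ‖ ^ 2 ≤ ∑ X ∈ terms h A, ‖localTerm h Λ X ψ‖ ^ 2 := by
  rw [← re_inner_sum_localTerm hp]
  rw [← ker_sum_localTerm hp] at hψ
  refine mul_norm_sq_le_inner_of_eigenvalues ?_
    (fun E hE => hγ E (mem_energies_of_hasEigenvalue h hA hE)) hψ
  exact LinearMap.isSymmetric_sum _ fun X _ => localTerm_isSymmetric hp Λ X

/-- An energy in `Λ` has an eigenvector in the Hilbert space of `Λ`. -/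
theorem exists_eigenvector {h : Interaction Γ d} (hp : ∀ X, IsStarProjection (h X)) {Λ : Finset Γ}
    {E : ℝ} (hE : E ∈ energies (hamiltonian h Λ)) (hE0 : E ≠ 0) :
    ∃ ψ : EuclideanSpace ℂ (Config d Λ), ψ ≠ 0 ∧
      ψ ∈ (commonKer (localTerm h Λ) (terms h Λ))ᗮ ∧
      ∑ X ∈ terms h Λ, ‖localTerm h Λ X ψ‖ ^ 2 = E * ‖ψ‖ ^ 2 := by
  obtain ⟨v, hv0, hv⟩ := mem_energies_iff.1 hE
  have hψ : (∑ X ∈ terms h Λ, localTerm h Λ X) (WithLp.toLp 2 v) = (E : ℂ) • WithLp.toLp 2 v := by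
    apply WithLp.ofLp_injective
    funext σ
    have h1 := ofLp_sum_localTerm_glue h (Finset.Subset.refl Λ) (WithLp.toLp 2 v) σ σ
    have h2 : ∀ τ : Config d Λ, glue σ τ = τ := fun τ => by funext x; simp [glue]
    simp only [h2] at h1
    rw [h1, hv]
    rfl
  have hsymm : (∑ X ∈ terms h Λ, localTerm h Λ X).IsSymmetric :=
    LinearMap.isSymmetric_sum _ fun X _ => localTerm_isSymmetric hp Λ X
  refine ⟨WithLp.toLp 2 v, fun h0 => hv0 (by simpa using h0), ?_, ?_⟩
  · rw [← ker_sum_localTerm hp]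
    intro φ hφ
    have h1 := hsymm φ (WithLp.toLp 2 v)
    rw [LinearMap.mem_ker.1 hφ, inner_zero_left, hψ, inner_smul_right] at h1
    have hE0' : (E : ℂ) ≠ 0 := by exact_mod_cast hE0
    exact (mul_eq_zero.1 h1.symm).resolve_left hE0'
  · rw [← re_inner_sum_localTerm hp, hψ, inner_smul_right, inner_self_eq_norm_sq_to_K]
    norm_cast
    exact (Complex.re_ofReal_mul _ _).trans (congrArg _ (Complex.ofReal_re _))

theorem finite_energies {Λ : Finset Γ} (A : Obs d Λ) : (energies A).Finite :=
  Set.Finite.preimage Complex.ofReal_injective.injOn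
    (Module.End.finite_hasEigenvalue (Matrix.toLin' A))

end Observables

/-! ### Consequences of frustration freeness for the spectrum. -/

section Admissible

variable {Γ : Type*} [MetricSpace Γ] [DecidableEq Γ] {d : ℕ} {h : Interaction Γ d}

theorem IsAdmissible.groundEnergy_hamiltonian (hh : IsAdmissible h) (Λ : Finset Γ) :
    groundEnergy (hamiltonian h Λ) = 0 := by
  -- For `d = 0` and nonempty `Λ` the Hilbert space is zero and there are no energies; the infimum
  -- of the empty set is `0` by convention.
  rcases (energies (hamiltonian h Λ)).eq_empty_or_nonempty with h0 | h0
  · rw [groundEnergy, h0, Real.sInf_empty]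
  · obtain ⟨v, hv0, hv⟩ := mem_energies_iff.1 (h0.csInf_mem (finite_energies _))
    have hmem : v ∈ groundSpace (hamiltonian h Λ) :=
      Module.End.mem_eigenspace_iff.2 hv
    have h1 : hamiltonian h Λ *ᵥ v = 0 := by
      rw [hamiltonian_mulVec]
      refine Finset.sum_eq_zero fun X _ => ?_
      rw [hh.frustration_free Λ X.1 (Finset.mem_powerset.1 X.2) v hmem,
        hh.groundEnergy_eq_zero, Complex.ofReal_zero, zero_smul]
    rw [h1] at hv
    have := (smul_eq_zero.1 hv.symm).resolve_right hv0
    exact_mod_cast this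

theorem IsAdmissible.energies_nonneg (hh : IsAdmissible h) {Λ : Finset Γ} {E : ℝ}
    (hE : E ∈ energies (hamiltonian h Λ)) : 0 ≤ E := by
  rw [← hh.groundEnergy_hamiltonian Λ]
  exact csInf_le (finite_energies _).bddBelow hE

theorem IsAdmissible.ofReal_le_spectralGap_iff (hh : IsAdmissible h) {γ : ℝ} {Λ : Finset Γ} :
    ENNReal.ofReal γ ≤ spectralGap h Λ ↔ GapAtLeast h γ Λ := by
  rw [spectralGap, hh.groundEnergy_hamiltonian]
  simp only [le_iInf_iff, sub_zero]
  constructor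
  · intro H E hE
    by_cases hE0 : E = 0
    · exact Or.inl hE0
    · exact Or.inr ((ENNReal.ofReal_le_ofReal_iff (hh.energies_nonneg hE)).1 (H E ⟨hE, hE0⟩))
  · rintro H E ⟨hE, hE0⟩
    exact ENNReal.ofReal_le_ofReal ((H E hE).resolve_left hE0)

/-- The smallest nonzero energy, if there is one. -/
theorem IsAdmissible.exists_min_energy (hh : IsAdmissible h) {Λ : Finset Γ} {E : ℝ}
    (hE : E ∈ energies (hamiltonian h Λ)) (hE0 : E ≠ 0) :
    ∃ x ∈ energies (hamiltonian h Λ), 0 < x ∧ x ≤ E ∧ GapAtLeast h x Λ := by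
  obtain ⟨x, ⟨hx, hx0⟩, hmin⟩ := Set.exists_min_image (energies (hamiltonian h Λ) \ {0}) id
    ((finite_energies _).subset Set.sdiff_subset) ⟨E, hE, hE0⟩
  refine ⟨x, hx, lt_of_le_of_ne (hh.energies_nonneg hx) (Ne.symm hx0), hmin E ⟨hE, hE0⟩, ?_⟩
  intro E' hE'
  by_cases h0 : E' = 0
  · exact Or.inl h0
  · exact Or.inr (hmin E' ⟨hE', h0⟩)

/-- On a one-dimensional space a projection is `0` or `1`, and `1` has lowest energy `1`. Hence
every nonzero term contains a site, which the counting arguments need. -/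
theorem IsAdmissible.apply_empty (hh : IsAdmissible h) : h ∅ = 0 := by
  set p : ℂ := h ∅ default default with hp
  have hconst : h ∅ = p • (1 : Obs d (∅ : Finset Γ)) := by
    ext σ τ
    rw [Subsingleton.elim σ default, Subsingleton.elim τ default]
    simp [hp]
  have hidem := (hh.projection ∅).isIdempotentElem.eq
  have hpp : p * p = p := by
    have := congrFun (congrFun hidem default) default
    rwa [Matrix.mul_apply, Fintype.sum_unique] at this
  by_cases hp0 : p = 0
  · rw [hconst, hp0, zero_smul]
  · exfalso
    have hp1 : p = 1 := mul_right_cancel₀ hp0 (by rw [hpp, one_mul])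
    rw [hp1, one_smul] at hconst
    have hen : energies (h ∅) = {1} := by
      ext E
      rw [mem_energies_iff, hconst]
      simp only [Matrix.one_mulVec, Set.mem_singleton_iff]
      constructor
      · rintro ⟨v, hv0, hv⟩
        have h1 : (1 - (E : ℂ)) • v = 0 := by rw [sub_smul, one_smul, ← hv, sub_self]
        have h2 := (smul_eq_zero.1 h1).resolve_right hv0
        have h3 : (E : ℂ) = 1 := (sub_eq_zero.1 h2).symm
        exact_mod_cast h3
      · rintro rfl
        exact ⟨fun _ => 1, fun h0 => one_ne_zero (congrFun h0 default), by simp⟩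
    have := hh.groundEnergy_eq_zero ∅
    rw [groundEnergy, hen, csInf_singleton] at this
    exact one_ne_zero this

end Admissible

/-! ### Energy of a region covered by two overlapping parts. -/

section Splitting

variable {Γ : Type*} [DecidableEq Γ] {d : ℕ} {h : Interaction Γ d}

/-- The terms in `A` annihilate the projection, so subtracting it leaves the energy unchanged. -/
theorem GapAtLeast.mul_norm_sub_starProjection_sq_le (hp : ∀ X, IsStarProjection (h X))
    {γ : ℝ} {A Λ : Finset Γ} (hA : A ⊆ Λ) (hγ : GapAtLeast h γ A)
    (ψ : EuclideanSpace ℂ (Config d Λ)) :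
    γ * ‖ψ - (commonKer (localTerm h Λ) (terms h A)).starProjection ψ‖ ^ 2 ≤
      ∑ X ∈ terms h A, ‖localTerm h Λ X ψ‖ ^ 2 := by
  refine (hγ.mul_norm_sq_le hp hA (Submodule.sub_starProjection_mem_orthogonal ψ)).trans_eq ?_
  refine Finset.sum_congr rfl fun X hX => ?_
  rw [map_sub, mem_commonKer.1 (Submodule.starProjection_apply_mem _ ψ) X hX, sub_zero]

open Classical in
/-- Quasi-factorization of the energy of a region covered by two regions whose overlap has width
at least `2 * m * R` in the direction of the coordinate `f`. -/
theorem energy_le_energy_add_energy (hp : ∀ X, IsStarProjection (h X)) {f : Γ → ℝ} {R : ℝ}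
    (hR : 0 ≤ R)
    (hf : ∀ X, h X ≠ 0 → ∀ x ∈ X, ∀ y ∈ X, f y ≤ f x + R) {g : ℕ} (hg0 : 0 < g) {Λ : Finset Γ}
    (hg : ∀ X ∈ terms h Λ, ((terms h Λ).filter fun Y => ¬ Commute
      (localTerm h Λ X : Module.End ℂ (EuclideanSpace ℂ (Config d Λ))) (localTerm h Λ Y)).card ≤ g)
    {x γ a w : ℝ} (hx0 : 0 ≤ x) (hx : GapAtLeast h x Λ) {m : ℕ} (hm : 2 * m * R ≤ w)
    (hγ0 : 0 ≤ γ)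
    (hA : GapAtLeast h γ (Λ.filter fun u => f u < a + w))
    (hB : GapAtLeast h γ (Λ.filter fun u => a ≤ f u))
    {ψ : EuclideanSpace ℂ (Config d Λ)} (hψ : ψ ∈ (commonKer (localTerm h Λ) (terms h Λ))ᗮ) :
    γ * ((1 - 1 / (1 + m * (x / (g : ℝ) ^ 2))) * ‖ψ‖ ^ 2) ≤
      ∑ X ∈ terms h (Λ.filter fun u => f u < a + w), ‖localTerm h Λ X ψ‖ ^ 2 +
      ∑ X ∈ terms h (Λ.filter fun u => a ≤ f u), ‖localTerm h Λ X ψ‖ ^ 2 := by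
  refine le_trans ?_ (add_le_add
    (hA.mul_norm_sub_starProjection_sq_le hp (Finset.filter_subset _ _) ψ)
    (hB.mul_norm_sub_starProjection_sq_le hp (Finset.filter_subset _ _) ψ))
  rw [← mul_add]
  refine mul_le_mul_of_nonneg_left ?_ hγ0
  refine sub_mul_norm_sq_le_of_almost_orthogonal
    (commonKer_anti _ (terms_mono h (Finset.filter_subset _ _))) (by positivity) ?_ hψ
  intro y hy z hz hzG
  have hcut : ∀ s t : ℕ, s < t → a + (2 * m - 1 - t) * R + R ≤ a + (2 * m - 1 - s) * R := by
    intro s t hst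
    have : (s : ℝ) + 1 ≤ t := by exact_mod_cast hst
    nlinarith
  -- The cut positions `a + (2m - 1 - t) R` move left in steps of `R` from `a + (2m - 1) R` to `a`.
  -- A term has extent at most `R`, so one to the right of an earlier cut is disjoint from one that
  -- meets the left of a later cut, and the two commute.
  refine norm_inner_le_of_cuts (localTerm_isSymmetric hp Λ) (localTerm_localTerm hp Λ) hg0 hg hx0
    (fun φ hφ => hx.mul_norm_sq_le hp (Finset.Subset.refl Λ) hφ)
    (fun t X => ∃ u ∈ X, f u < a + (2 * m - 1 - t) * R) ?_ ?_ ?_ hy hz hzG (m := m)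
  · rintro t ht X hX ⟨u, hu, hut⟩
    rw [mem_terms] at hX ⊢
    refine ⟨fun v hv => Finset.mem_filter.2 ⟨hX.1 hv, ?_⟩, hX.2⟩
    have h1 := hf X hX.2 u hu v hv
    have h2 : (0 : ℝ) ≤ t := Nat.cast_nonneg t
    nlinarith
  · intro t ht X hX hu
    push Not at hu
    rw [mem_terms] at hX ⊢
    refine ⟨fun v hv => Finset.mem_filter.2 ⟨hX.1 hv, ?_⟩, hX.2⟩
    have h1 := hu v hv
    have h2 : (t : ℝ) + 1 ≤ 2 * m := by exact_mod_cast ht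
    nlinarith
  · rintro s t hst ht X hX Y hY hu ⟨v, hv, hvt⟩
    push Not at hu
    refine localTerm_commute h Λ (Finset.disjoint_left.2 fun u huX huY => ?_)
    have h1 := hu u huX
    have h2 := hf Y (mem_terms.1 hY).2 v hv u huY
    have h3 := hcut s t hst
    linarith

open Classical in
theorem terms_filter (h : Interaction Γ d) {A Λ : Finset Γ} (hA : A ⊆ Λ) :
    terms h A = (terms h Λ).filter fun X => X ⊆ A := by
  ext X
  simp only [mem_terms, Finset.mem_filter]
  exact ⟨fun H => ⟨⟨H.1.trans hA, H.2⟩, H.1⟩, fun H => ⟨H.2, H.1.2⟩⟩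

/-- If `s` pairs of regions have pairwise disjoint overlaps, then together they contain every
nonempty set at most `s + 1` times. -/
theorem card_filter_subset_add_card_filter_subset_le {s : ℕ} {A B : ℕ → Finset Γ}
    (hAB : ∀ i < s, ∀ j < s, ∀ u, u ∈ A i → u ∈ B i → u ∈ A j → u ∈ B j → i = j)
    {X : Finset Γ} (hX : X.Nonempty) :
    ((Finset.range s).filter fun j => X ⊆ A j).card +
      ((Finset.range s).filter fun j => X ⊆ B j).card ≤ s + 1 := by
  rw [← Finset.card_union_add_card_inter]
  refine add_le_add ?_ (Finset.card_le_one.2 fun i hi j hj => ?_)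
  · refine (Finset.card_le_card (Finset.union_subset (Finset.filter_subset _ _)
      (Finset.filter_subset _ _))).trans_eq (Finset.card_range s)
  · simp only [Finset.mem_inter, Finset.mem_filter, Finset.mem_range] at hi hj
    obtain ⟨u, hu⟩ := hX
    exact hAB i hi.1.1 j hj.1.1 u (hi.1.2 hu) (hi.2.2 hu) (hj.1.2 hu) (hj.2.2 hu)

end Splitting

/-! ### The self-consistent inequality for the gap of a larger region. -/

section Step

variable {Γ : Type*} [MetricSpace Γ] [DecidableEq Γ] {d : ℕ} {h : Interaction Γ d}

open Classical in
/-- The gap of a region of width `3 / 2 * L` in terms of the gaps of its parts of width `L`. -/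
theorem IsAdmissible.gapAtLeast_of_parts (hh : IsAdmissible h) {f : Γ → ℝ} {R : ℝ} (hR : 0 ≤ R)
    (hf : ∀ X, h X ≠ 0 → ∀ x ∈ X, ∀ y ∈ X, f y ≤ f x + R) {g : ℕ} (hg0 : 0 < g) {Λ : Finset Γ}
    (hg : ∀ X ∈ terms h Λ, ((terms h Λ).filter fun Y => ¬ Commute
      (localTerm h Λ X : Module.End ℂ (EuclideanSpace ℂ (Config d Λ))) (localTerm h Λ Y)).card ≤ g)
    {γ L b : ℝ} (hγ0 : 0 ≤ γ) (hL : 0 < L) {s m : ℕ} (hs : 0 < s) (hm0 : 0 < m)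
    (hm : 2 * m * R ≤ L / (2 * s)) (hΛ : ∀ u ∈ Λ, b ≤ f u ∧ f u ≤ b + 3 / 2 * L)
    (hparts : ∀ A ⊆ Λ, ∀ a, (∀ u ∈ A, a ≤ f u ∧ f u ≤ a + L) → GapAtLeast h γ A) :
    GapAtLeast h (γ * (s / (s + 1)) - (g : ℝ) ^ 2 / m) Λ := by
  intro E hE
  by_cases hE0 : E = 0
  · exact Or.inl hE0
  right
  obtain ⟨x, hxE, hx0, hxle, hx⟩ := hh.exists_min_energy hE hE0
  refine le_trans ?_ hxle
  obtain ⟨ψ, hψ0, hψ, hψE⟩ := exists_eigenvector hh.projection hxE hx0.ne'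
  have hs' : (0 : ℝ) < s := by exact_mod_cast hs
  have hm0' : (0 : ℝ) < m := by exact_mod_cast hm0
  have hg0' : (0 : ℝ) < g := by exact_mod_cast hg0
  -- The `s` overlaps of width `w` tile the middle third `[b + L/2, b + L)`, so the parts on either
  -- side have width at most `L`.
  set w := L / (2 * s) with hw
  have hw0 : 0 < w := by positivity
  have hsw : s * w = L / 2 := by rw [hw]; field_simp
  set a : ℕ → ℝ := fun j => b + L / 2 + j * w with ha
  set A : ℕ → Finset Γ := fun j => Λ.filter fun u => f u < a j + w with hA
  set B : ℕ → Finset Γ := fun j => Λ.filter fun u => a j ≤ f u with hB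
  have hpair : ∀ j ∈ Finset.range s, γ * ((1 - 1 / (1 + m * (x / (g : ℝ) ^ 2))) * ‖ψ‖ ^ 2) ≤
      ∑ X ∈ terms h (A j), ‖localTerm h Λ X ψ‖ ^ 2 +
      ∑ X ∈ terms h (B j), ‖localTerm h Λ X ψ‖ ^ 2 := by
    intro j hj
    have hj' : (j : ℝ) + 1 ≤ s := by exact_mod_cast Finset.mem_range.1 hj
    have hj0 : (0 : ℝ) ≤ j := Nat.cast_nonneg j
    refine energy_le_energy_add_energy hh.projection hR hf hg0 hg hx0.le hx hm hγ0
      (hparts _ (Finset.filter_subset _ _) b fun u hu => ?_)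
      (hparts _ (Finset.filter_subset _ _) (a j) fun u hu => ?_) hψ
    · rw [Finset.mem_filter] at hu
      refine ⟨(hΛ u hu.1).1, hu.2.le.trans ?_⟩
      simp only [ha]
      nlinarith
    · rw [Finset.mem_filter] at hu
      refine ⟨hu.2, (hΛ u hu.1).2.trans ?_⟩
      simp only [ha]
      nlinarith
  have hdisj : ∀ i < s, ∀ j < s, ∀ u, u ∈ A i → u ∈ B i → u ∈ A j → u ∈ B j → i = j := by
    have key : ∀ i j u, u ∈ A i → u ∈ B j → j ≤ i := by
      intro i j u hi hj
      have h1 := (Finset.mem_filter.1 hi).2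
      have h2 := (Finset.mem_filter.1 hj).2
      by_contra! hlt
      have h3 : (i : ℝ) + 1 ≤ j := by exact_mod_cast hlt
      simp only [ha] at h1 h2
      nlinarith
    exact fun i _ j _ u h1 h2 h3 h4 => le_antisymm (key j i u h3 h2) (key i j u h1 h4)
  have hsum := Finset.sum_le_sum hpair
  rw [Finset.sum_const, Finset.card_range, nsmul_eq_mul, Finset.sum_add_distrib] at hsum
  have hswap : ∀ C : ℕ → Finset Γ, (∀ j, C j ⊆ Λ) →
      ∑ j ∈ Finset.range s, ∑ X ∈ terms h (C j), ‖localTerm h Λ X ψ‖ ^ 2 =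
      ∑ X ∈ terms h Λ, ((Finset.range s).filter fun j => X ⊆ C j).card *
        ‖localTerm h Λ X ψ‖ ^ 2 := by
    intro C hC
    simp_rw [fun j => terms_filter h (hC j), Finset.sum_filter]
    rw [Finset.sum_comm]
    refine Finset.sum_congr rfl fun X _ => ?_
    rw [← Finset.sum_filter, Finset.sum_const, nsmul_eq_mul]
  rw [hswap A fun j => Finset.filter_subset _ _, hswap B fun j => Finset.filter_subset _ _,
    ← Finset.sum_add_distrib] at hsum
  have hbound : s * (γ * ((1 - 1 / (1 + m * (x / (g : ℝ) ^ 2))) * ‖ψ‖ ^ 2)) ≤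
      (s + 1) * (x * ‖ψ‖ ^ 2) := by
    rw [← hψE, Finset.mul_sum]
    refine hsum.trans (Finset.sum_le_sum fun X hX => ?_)
    rw [← add_mul]
    refine mul_le_mul_of_nonneg_right ?_ (sq_nonneg _)
    have hXne : X.Nonempty := by
      rw [Finset.nonempty_iff_ne_empty]
      rintro rfl
      exact (mem_terms.1 hX).2 hh.apply_empty
    exact_mod_cast card_filter_subset_add_card_filter_subset_le hdisj hXne
  have hψ2 : 0 < ‖ψ‖ ^ 2 := by positivity
  set y := (m : ℝ) / (g : ℝ) ^ 2 with hy
  have hy0 : 0 < y := by positivity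
  have hmy : m * (x / (g : ℝ) ^ 2) = y * x := by rw [hy]; ring
  have hgy : (g : ℝ) ^ 2 / m = 1 / y := by rw [hy]; field_simp
  rw [hmy] at hbound
  have hyx : 0 < 1 + y * x := by positivity
  have h1 : s * γ * (y * x / (1 + y * x)) ≤ (s + 1) * x := by
    have h2 : 1 - 1 / (1 + y * x) = y * x / (1 + y * x) := by field_simp; ring
    rw [h2] at hbound
    exact le_of_mul_le_mul_right (by linarith) hψ2
  rw [← mul_div_assoc, div_le_iff₀ hyx] at h1
  -- The gap `x > 0` of `Λ` occurs on both sides and cancels; the remaining inequality is linear in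
  -- `x`.
  have h3 : s * γ * y ≤ (s + 1) * (1 + y * x) := le_of_mul_le_mul_right (by linarith) hx0
  rw [hgy, sub_le_iff_le_add, ← mul_div_assoc, div_le_iff₀ (by positivity)]
  have h4 : (x + 1 / y) * (s + 1) = (s + 1) * (1 + y * x) / y := by field_simp; ring
  rw [h4, le_div_iff₀ hy0]
  linarith

end Step

/-! ### Coordinates and packing bounds. -/

section Geometry

/-- Coordinates on a metric space that embeds in a finite dimensional normed space. -/
theorem exists_coordinates {E : Type*} [NormedAddCommGroup E] [NormedSpace ℝ E]
    [FiniteDimensional ℝ E] {Γ : Type*} [MetricSpace Γ] {ι : Γ → E} (hι : Isometry ι) :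
    ∃ (D : ℕ) (f : Fin D → Γ → ℝ) (M : ℝ), 0 < M ∧
      (∀ i u v, |f i u - f i v| ≤ M * dist u v) ∧
      ∀ u v t, 0 ≤ t → (∀ i, |f i u - f i v| ≤ t) → dist u v ≤ M * t := by
  set e := (Module.finBasis ℝ E).equivFunL with he
  set M := ‖(e : E →L[ℝ] (Fin (Module.finrank ℝ E) → ℝ))‖ +
    ‖(e.symm : (Fin (Module.finrank ℝ E) → ℝ) →L[ℝ] E)‖ + 1 with hM
  have h1 := norm_nonneg (e : E →L[ℝ] (Fin (Module.finrank ℝ E) → ℝ))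
  have h2 := norm_nonneg (e.symm : (Fin (Module.finrank ℝ E) → ℝ) →L[ℝ] E)
  refine ⟨_, fun i u => e (ι u) i, M, by positivity, fun i u v => ?_, fun u v t ht huv => ?_⟩
  · rw [← hι.dist_eq, dist_eq_norm, ← Pi.sub_apply, ← map_sub]
    refine (norm_le_pi_norm (e (ι u - ι v)) i).trans ?_
    refine ((e : E →L[ℝ] (Fin (Module.finrank ℝ E) → ℝ)).le_opNorm _).trans
      (mul_le_mul_of_nonneg_right ?_ (norm_nonneg _))
    linarith
  · rw [← hι.dist_eq, dist_eq_norm]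
    have h3 : ‖e (ι u - ι v)‖ ≤ t := by
      rw [pi_norm_le_iff_of_nonneg ht]
      intro i
      rw [map_sub]
      exact huv i
    calc ‖ι u - ι v‖ = ‖e.symm (e (ι u - ι v))‖ := by rw [e.symm_apply_apply]
      _ ≤ ‖(e.symm : (Fin (Module.finrank ℝ E) → ℝ) →L[ℝ] E)‖ * ‖e (ι u - ι v)‖ :=
        (e.symm : (Fin (Module.finrank ℝ E) → ℝ) →L[ℝ] E).le_opNorm _
      _ ≤ M * t := mul_le_mul (by linarith) h3 (norm_nonneg _) (by positivity)

/-- The balls of a given radius contain a bounded number of points of a uniformly discrete set. -/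
theorem exists_card_le_of_dist_le {Γ : Type*} [MetricSpace Γ] {D : ℕ} {f : Fin D → Γ → ℝ} {M : ℝ}
    (hM : 0 < M) (hf : ∀ i u v, |f i u - f i v| ≤ M * dist u v)
    (hf' : ∀ u v t, 0 ≤ t → (∀ i, |f i u - f i v| ≤ t) → dist u v ≤ M * t)
    {ρ : ℝ} (hρ : 0 < ρ) (hsep : ∀ x y : Γ, x ≠ y → ρ ≤ dist x y) (b : ℝ) :
    ∃ N : ℕ, ∀ (u : Γ) (F : Finset Γ), (∀ v ∈ F, dist v u ≤ b) → F.card ≤ N := by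
  -- Points in the same cell of side `η` are within `M * η = ρ / 2 < ρ`, so each cell holds at most
  -- one.
  set η := ρ / (2 * M) with hη
  have hη0 : 0 < η := by positivity
  set k : ℤ := ⌈M * b / η⌉ + 1 with hk
  refine ⟨(Fintype.piFinset fun _ : Fin D => Finset.Icc (-k) k).card, fun u F hF => ?_⟩
  refine Finset.card_le_card_of_injOn (fun v i => ⌊f i v / η⌋ - ⌊f i u / η⌋) (fun v hv => ?_)
    (fun v _ v' _ hvv => ?_)
  · rw [Finset.mem_coe, Fintype.mem_piFinset]
    intro i
    have h1 : |f i v - f i u| ≤ M * b :=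
      (hf i v u).trans (mul_le_mul_of_nonneg_left (hF v hv) hM.le)
    have h2 : |f i v / η - f i u / η| ≤ M * b / η := by
      rw [← sub_div, abs_div, abs_of_pos hη0]
      exact div_le_div_of_nonneg_right h1 hη0.le
    have h3 := abs_le.1 h2
    have h4 := Int.le_ceil (M * b / η)
    have h5 := Int.floor_le (f i v / η)
    have h6 := Int.lt_floor_add_one (f i v / η)
    have h7 := Int.floor_le (f i u / η)
    have h8 := Int.lt_floor_add_one (f i u / η)
    rw [Finset.mem_Icc]
    constructor
    · have : ((-k : ℤ) : ℝ) ≤ ((⌊f i v / η⌋ - ⌊f i u / η⌋ : ℤ) : ℝ) := by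
        push_cast [hk]; linarith
      exact_mod_cast this
    · have : ((⌊f i v / η⌋ - ⌊f i u / η⌋ : ℤ) : ℝ) ≤ ((k : ℤ) : ℝ) := by
        push_cast [hk]; linarith
      exact_mod_cast this
  · by_contra hne
    have h1 : dist v v' ≤ M * η := hf' v v' η hη0.le fun i => by
      have h2 : ⌊f i v / η⌋ = ⌊f i v' / η⌋ := by
        have := congrFun hvv i
        simpa using this
      have h3 := (Int.abs_sub_lt_one_of_floor_eq_floor h2).le
      rwa [← sub_div, abs_div, abs_of_pos hη0, div_le_one hη0] at h3
    have h4 : M * η = ρ / 2 := by rw [hη]; field_simp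
    linarith [hsep v v' hne]

theorem dist_le_of_finite_range {Γ : Type*} [MetricSpace Γ] {d : ℕ} {h : Interaction Γ d} {r : ℝ}
    (hr : ∀ X : Finset Γ, r < Metric.diam (X : Set Γ) → h X = 0) {X : Finset Γ} (hX : h X ≠ 0)
    {x y : Γ} (hx : x ∈ X) (hy : y ∈ X) : dist x y ≤ r := by
  refine (Metric.dist_le_diam_of_mem X.finite_toSet.isBounded (Finset.mem_coe.2 hx)
    (Finset.mem_coe.2 hy)).trans ?_
  by_contra! hlt
  exact hX (hr X hlt)

end Geometry

/-! ### Induction over length scales and the resulting `1 / n` decay. -/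

section Scales

variable {Γ : Type*} [MetricSpace Γ] [DecidableEq Γ] {d : ℕ} {h : Interaction Γ d}

open Classical in
/-- Every interaction term fails to commute with a bounded number of other terms. -/
theorem IsAdmissible.card_filter_not_commute_le (hh : IsAdmissible h) {r : ℝ}
    (hr : ∀ X : Finset Γ, r < Metric.diam (X : Set Γ) → h X = 0) {N : ℕ}
    (hN : ∀ (u : Γ) (F : Finset Γ), (∀ v ∈ F, dist v u ≤ 2 * r) → F.card ≤ N) {Λ X : Finset Γ}
    (hX : X ∈ terms h Λ) :
    ((terms h Λ).filter fun Y => ¬ Commute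
      (localTerm h Λ X : Module.End ℂ (EuclideanSpace ℂ (Config d Λ))) (localTerm h Λ Y)).card ≤
      2 ^ N := by
  have hXne : X.Nonempty := by
    rw [Finset.nonempty_iff_ne_empty]
    rintro rfl
    exact (mem_terms.1 hX).2 hh.apply_empty
  obtain ⟨u, hu⟩ := hXne
  set U := Λ.filter fun v => dist v u ≤ 2 * r with hU
  have hUN : U.card ≤ N := hN u U fun v hv => (Finset.mem_filter.1 hv).2
  have hsub : ((terms h Λ).filter fun Y => ¬ Commute
      (localTerm h Λ X : Module.End ℂ (EuclideanSpace ℂ (Config d Λ))) (localTerm h Λ Y)) ⊆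
      U.powerset := by
    intro Y hY
    obtain ⟨hYt, hYc⟩ := Finset.mem_filter.1 hY
    -- A noncommuting term shares a site with `X`, so it is one of the at most `2 ^ N` subsets of a
    -- ball of radius `2 * r`.
    obtain ⟨z, hzX, hzY⟩ := Finset.not_disjoint_iff.1 fun hd => hYc (localTerm_commute h Λ hd)
    refine Finset.mem_powerset.2 fun v hv => Finset.mem_filter.2 ⟨(mem_terms.1 hYt).1 hv, ?_⟩
    have h1 := dist_le_of_finite_range hr (mem_terms.1 hYt).2 hv hzY
    have h2 := dist_le_of_finite_range hr (mem_terms.1 hX).2 hzX hu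
    linarith [dist_triangle v z u]
  refine (Finset.card_le_card hsub).trans ?_
  rw [Finset.card_powerset]
  exact Nat.pow_le_pow_right two_pos hUN

theorem IsAdmissible.gapAtLeast_of_nonpos (hh : IsAdmissible h) {γ : ℝ} (hγ : γ ≤ 0)
    (Λ : Finset Γ) : GapAtLeast h γ Λ := fun _ hE => Or.inr (hγ.trans (hh.energies_nonneg hE))

/-- All regions contained in a box with side lengths `ℓ` have gap at least `γ`. -/
def GapInBoxes {D : ℕ} (h : Interaction Γ d) (f : Fin D → Γ → ℝ) (ℓ : Fin D → ℝ) (γ : ℝ) : Prop :=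
  ∀ Λ : Finset Γ, (∀ i, ∃ b, ∀ u ∈ Λ, b ≤ f i u ∧ f i u ≤ b + ℓ i) → GapAtLeast h γ Λ

open Classical in
/-- Enlarging all sides of a box by a factor `3 / 2`, one after the other. -/
theorem IsAdmissible.gapInBoxes_mul (hh : IsAdmissible h) {D : ℕ} {f : Fin D → Γ → ℝ} {R : ℝ}
    (hR : 0 ≤ R) (hf : ∀ i X, h X ≠ 0 → ∀ x ∈ X, ∀ y ∈ X, f i y ≤ f i x + R) {g : ℕ} (hg0 : 0 < g)
    (hg : ∀ Λ, ∀ X ∈ terms h Λ, ((terms h Λ).filter fun Y => ¬ Commute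
      (localTerm h Λ X : Module.End ℂ (EuclideanSpace ℂ (Config d Λ))) (localTerm h Λ Y)).card ≤ g)
    {γ L : ℝ} (hγ0 : 0 ≤ γ) (hL : 0 < L) {s m : ℕ} (hs : 0 < s) (hm0 : 0 < m)
    (hm : 2 * m * R ≤ L / (2 * s)) (hbox : GapInBoxes h f (fun _ => L) γ) :
    GapInBoxes h f (fun _ => 3 / 2 * L) (γ * (1 - D / (s + 1)) - D * ((g : ℝ) ^ 2 / m)) := by
  set c := (g : ℝ) ^ 2 / m with hc
  have hc0 : 0 ≤ c := by positivity
  have hs' : (0 : ℝ) < s := by exact_mod_cast hs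
  have key : ∀ I : Finset (Fin D), GapInBoxes h f (fun i => if i ∈ I then 3 / 2 * L else L)
      (γ * (1 - I.card / (s + 1)) - I.card * c) := by
    intro I
    induction I using Finset.induction_on with
    | empty => simpa using hbox
    | insert i I hi ih =>
      intro Λ hΛ
      rw [Finset.card_insert_of_notMem hi]
      push_cast
      set k : ℝ := (I.card : ℝ) with hk
      have hk0 : 0 ≤ k := Nat.cast_nonneg _
      set γ' := γ * (1 - k / (s + 1)) - k * c with hγ'
      -- The losses of successive directions are combined by the linear lower bound for a product of
      -- factors `1 - 1/(s + 1)`. If `γ'` is already negative, the claim is trivial because energies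
      -- are nonnegative.
      have hle : γ * (1 - (k + 1) / (s + 1)) - (k + 1) * c ≤ γ' * (s / (s + 1)) - c := by
        have h1 : (s : ℝ) / (s + 1) = 1 - 1 / (s + 1) := by field_simp; ring
        set p : ℝ := 1 / (s + 1) with hp
        have hp0 : 0 ≤ p := by positivity
        have h2 : ∀ z : ℝ, z / (s + 1) = z * p := fun z => by rw [hp]; ring
        rw [h1, hγ', h2, h2]
        nlinarith [mul_nonneg hγ0 (mul_nonneg hk0 (mul_nonneg hp0 hp0)),
          mul_nonneg (mul_nonneg hk0 hc0) hp0]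
      rcases lt_or_ge γ' 0 with hneg | hpos
      · refine hh.gapAtLeast_of_nonpos (hle.trans ?_) Λ
        have : γ' * (s / (s + 1)) ≤ 0 := mul_nonpos_of_nonpos_of_nonneg hneg.le (by positivity)
        linarith
      · obtain ⟨b, hb⟩ := hΛ i
        simp only [Finset.mem_insert_self, if_true] at hb
        refine GapAtLeast.mono (hh.gapAtLeast_of_parts hR (hf i) hg0 (hg Λ) hpos hL hs hm0 hm hb
          fun A hA a ha => ih A fun j => ?_) hle
        by_cases hji : j = i
        · subst hji
          simpa only [hi, if_false] using ⟨a, ha⟩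
        · obtain ⟨b', hb'⟩ := hΛ j
          refine ⟨b', fun u hu => ?_⟩
          simpa [Finset.mem_insert, hji] using hb' u (hA hu)
  have := key Finset.univ
  simpa using this

open Classical in
/-- A lower bound on the gap at a single sufficiently large scale persists at all scales. -/
theorem IsAdmissible.gapAtLeast_of_gapInBoxes (hh : IsAdmissible h) {D : ℕ} {f : Fin D → Γ → ℝ}
    {R : ℝ} (hR : 0 < R) (hf : ∀ i X, h X ≠ 0 → ∀ x ∈ X, ∀ y ∈ X, f i y ≤ f i x + R) {g : ℕ}
    (hg0 : 0 < g)
    (hg : ∀ Λ, ∀ X ∈ terms h Λ, ((terms h Λ).filter fun Y => ¬ Commute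
      (localTerm h Λ X : Module.End ℂ (EuclideanSpace ℂ (Config d Λ))) (localTerm h Λ Y)).card ≤ g)
    {γ L : ℝ} (hγ0 : 0 < γ) (hL : 100 * (D + 1) * R ≤ L)
    (hγL : 4800 * (D + 1) ^ 2 * R * (g : ℝ) ^ 2 ≤ γ * L) (hbox : GapInBoxes h f (fun _ => L) γ)
    (Λ : Finset Γ) : GapAtLeast h (γ / 2) Λ := by
  have hL0 : 0 < L := lt_of_lt_of_le (by positivity) hL
  -- The step from `q` to `q + 1` may lose `γ/2 * t * (1 - 5/6) = γ t / 12`, where `t = (5/6)^q`;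
  -- half of this goes to `hloss` and half to `herr`.
  have key : ∀ q : ℕ, GapInBoxes h f (fun _ => L * (3 / 2) ^ q) (γ / 2 * (1 + (5 / 6) ^ q)) := by
    intro q
    induction q with
    | zero =>
      have : γ / 2 * (1 + (5 / 6) ^ 0) = γ := by ring
      rw [this]
      simpa using hbox
    | succ q ih =>
      set t : ℝ := (5 / 6) ^ q with ht
      have ht0 : 0 < t := by positivity
      have ht1 : t ≤ 1 := pow_le_one₀ (by norm_num) (by norm_num)
      set a : ℝ := (3 / 2) ^ q with ha
      have ha0 : 0 < a := by positivity
      -- With `s ~ 1/t` and `m ~ L a / s`, the error `g²/m` is of order `1/(L a t)`. It stays below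
      -- a multiple of `t` because `(5/6)² * (3/2) ≥ 1`.
      have hat : 1 ≤ t * t * a := by
        rw [ht, ha, ← mul_pow, ← mul_pow]
        exact one_le_pow₀ (by norm_num)
      have hD0 : (0 : ℝ) ≤ D := Nat.cast_nonneg D
      set s : ℕ := ⌈24 * ((D : ℝ) + 1) / t⌉₊ with hs
      have hs1 : 24 * ((D : ℝ) + 1) / t ≤ s := Nat.le_ceil _
      have hs2 : (s : ℝ) < 24 * ((D : ℝ) + 1) / t + 1 := Nat.ceil_lt_add_one (by positivity)
      have hs0 : (0 : ℝ) < s := lt_of_lt_of_le (by positivity) hs1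
      have hs1' : 24 * ((D : ℝ) + 1) ≤ s * t := (div_le_iff₀ ht0).1 hs1
      have hs2' : s * t ≤ 25 * (D + 1) := by
        have h1 : (s : ℝ) * t ≤ (24 * ((D : ℝ) + 1) / t + 1) * t :=
          mul_le_mul_of_nonneg_right hs2.le ht0.le
        rw [add_mul, div_mul_cancel₀ _ ht0.ne'] at h1
        linarith
      set z : ℝ := L * a / (4 * s * R) with hz
      -- The lower bound on `L` serves to make room for at least one pair of cuts, `m ≥ 1`.
      have hz1 : 1 ≤ z := by
        rw [hz, one_le_div (by positivity)]
        have h1 : 4 * s * R * t ≤ L := by nlinarith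
        have h2 : L ≤ L * a * t := by
          have : 1 ≤ a * t := by nlinarith [mul_pos ha0 ht0]
          nlinarith
        exact le_of_mul_le_mul_right (h1.trans h2) ht0
      set m : ℕ := ⌊z⌋₊ with hm
      have hm1 : (m : ℝ) ≤ z := Nat.floor_le (by linarith)
      have hm2 : z < m + 1 := Nat.lt_floor_add_one z
      have hm0 : 0 < m := Nat.floor_pos.2 hz1
      have hm0' : (1 : ℝ) ≤ m := by exact_mod_cast hm0
      have hm3 : z ≤ 2 * m := by linarith
      have hmR : 2 * m * R ≤ L * a / (2 * s) := by
        have h1 : L * a / (2 * s) = 2 * z * R := by rw [hz]; field_simp; ring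
        rw [h1]
        nlinarith
      have h := hh.gapInBoxes_mul hR.le hf hg0 hg (by positivity) (by positivity)
        (by exact_mod_cast hs0) hm0 hmR ih
      have hlen : (3 : ℝ) / 2 * (L * a) = L * (3 / 2) ^ (q + 1) := by rw [ha, pow_succ]; ring
      rw [hlen] at h
      refine fun Λ hΛ => (h Λ hΛ).mono ?_
      have hloss : (D : ℝ) / (s + 1) ≤ t / 24 := by
        rw [div_le_div_iff₀ (by positivity) (by norm_num)]
        nlinarith
      have herr : D * ((g : ℝ) ^ 2 / m) ≤ γ * t / 24 := by
        rw [← mul_div_assoc, div_le_div_iff₀ (by positivity) (by norm_num)]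
        have h1 : L * a ≤ 8 * s * R * m := by
          rw [hz, div_le_iff₀ (by positivity)] at hm3
          linarith
        have h2 : L ≤ 200 * (D + 1) * R * (t * m) := by
          have h3 : L ≤ L * a * (t * t) := by nlinarith
          have h4 : L * a * (t * t) ≤ 8 * s * R * m * (t * t) :=
            mul_le_mul_of_nonneg_right h1 (by positivity)
          have h5 : 8 * s * R * m * (t * t) = 8 * R * (t * m) * (s * t) := by ring
          have h6 : 8 * R * (t * m) * (s * t) ≤ 8 * R * (t * m) * (25 * (D + 1)) :=
            mul_le_mul_of_nonneg_left hs2' (by positivity)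
          linarith
        have h7 : γ * L ≤ γ * (200 * (D + 1) * R * (t * m)) :=
          mul_le_mul_of_nonneg_left h2 hγ0.le
        have h8 : (200 * (D + 1) * R) * (24 * (D + 1) * (g : ℝ) ^ 2) ≤
            (200 * (D + 1) * R) * (γ * (t * m)) := by linarith
        have h9 := le_of_mul_le_mul_left h8 (by positivity)
        nlinarith [sq_nonneg (g : ℝ)]
      have h1 : γ / 2 * (1 + t) * (D / (s + 1)) ≤ γ * (t / 24) := by
        refine mul_le_mul ?_ hloss (by positivity) hγ0.le
        nlinarith
      rw [pow_succ, ← ht]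
      linarith
  obtain ⟨q, hq⟩ : ∃ q : ℕ, ∀ i, ∀ u ∈ Λ, |f i u| ≤ L * (3 / 2) ^ q / 2 := by
    have hfin : (Set.range fun p : Fin D × Λ => |f p.1 p.2|).Finite := Set.finite_range _
    obtain ⟨C, hC⟩ := hfin.bddAbove
    obtain ⟨q, hq⟩ := pow_unbounded_of_one_lt (2 * C / L) (by norm_num : (1 : ℝ) < 3 / 2)
    refine ⟨q, fun i u hu => (hC ⟨(i, ⟨u, hu⟩), rfl⟩).trans ?_⟩
    rw [div_lt_iff₀ hL0] at hq
    linarith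
  refine (key q Λ fun i => ⟨-(L * (3 / 2) ^ q / 2), fun u hu => ?_⟩).mono ?_
  · have := abs_le.1 (hq i u hu)
    constructor <;> linarith
  · have : (0 : ℝ) < (5 / 6) ^ q := by positivity
    nlinarith

/-- The gap of a gapless interaction decays at least as fast as `1 / n`. -/
theorem IsAdmissible.exists_gapAtScale_le (hh : IsAdmissible h) {E : Type*} [NormedAddCommGroup E]
    [NormedSpace ℝ E] [FiniteDimensional ℝ E] {ι : Γ → E} (hι : Isometry ι) {ρ : ℝ} (hρ : 0 < ρ)
    (hsep : ∀ x y : Γ, x ≠ y → ρ ≤ dist x y) (hgapless : IsGapless h) :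
    ∃ K : ℝ, ∀ᶠ n : ℝ in atTop, gapAtScale h n ≤ ENNReal.ofReal (K / n) := by
  classical
  obtain ⟨D, f, M, hM, hf, hf'⟩ := exists_coordinates hι
  obtain ⟨r, hr0, hr⟩ := hh.finite_range
  obtain ⟨N, hN⟩ := exists_card_le_of_dist_le hM hf hf' hρ hsep (2 * r)
  set R := M * r with hR
  have hR0 : 0 < R := by positivity
  have hfR : ∀ i X, h X ≠ 0 → ∀ x ∈ X, ∀ y ∈ X, f i y ≤ f i x + R := by
    intro i X hX x hx y hy
    have h1 := (abs_le.1 (hf i y x)).2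
    have h2 := mul_le_mul_of_nonneg_left (dist_le_of_finite_range hr hX hy hx) hM.le
    linarith
  set g : ℕ := 2 ^ N with hg
  -- Chosen so that `γ = K / n` and `L = n / M` meet the threshold on `γ * L` with equality; a box
  -- of side `n / M` has diameter at most `n`.
  set K : ℝ := 4800 * (D + 1) ^ 2 * R * (g : ℝ) ^ 2 * M with hK
  have hg0 : 0 < g := by positivity
  have hg0' : (0 : ℝ) < g := by exact_mod_cast hg0
  have hK0 : 0 < K := by positivity
  refine ⟨K, ?_⟩
  filter_upwards [eventually_ge_atTop (100 * (D + 1) * R * M), eventually_gt_atTop 0]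
    with n hn hn0
  by_contra! hlt
  refine hgapless (lt_of_lt_of_le ?_ (le_iInf fun Λ => hh.ofReal_le_spectralGap_iff.2
    (hh.gapAtLeast_of_gapInBoxes hR0 hfR hg0 (fun Λ X hX => hh.card_filter_not_commute_le hr hN hX)
      (γ := K / n) (L := n / M) (by positivity) ?_ ?_ ?_ Λ)))
  · exact ENNReal.ofReal_pos.2 (by positivity)
  · rwa [le_div_iff₀ hM]
  · have : K / n * (n / M) = 4800 * (D + 1) ^ 2 * R * (g : ℝ) ^ 2 := by
      rw [hK]; field_simp
    rw [this]
  · intro Λ hΛ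
    rw [← hh.ofReal_le_spectralGap_iff]
    refine hlt.le.trans (iInf₂_le Λ ?_)
    refine Metric.diam_le_of_forall_dist_le hn0.le fun u hu v hv => ?_
    refine (hf' u v (n / M) (by positivity) fun i => ?_).trans_eq (mul_div_cancel₀ _ hM.ne')
    obtain ⟨b, hb⟩ := hΛ i
    have h1 := hb u hu
    have h2 := hb v hv
    rw [abs_le]
    constructor <;> linarith

end Scales

theorem eventually_gapAtScale_ne_top {Γ : Type*} [MetricSpace Γ] [DecidableEq Γ] {d : ℕ}
    {h : Interaction Γ d} (hgapless : IsGapless h) : ∀ᶠ n : ℝ in atTop, gapAtScale h n ≠ ∞ := by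
  have h0 : ⨅ Λ : Finset Γ, spectralGap h Λ < ∞ :=
    lt_of_le_of_lt (not_lt.1 hgapless) ENNReal.zero_lt_top
  obtain ⟨Λ, hΛ⟩ := iInf_lt_iff.1 h0
  filter_upwards [eventually_ge_atTop (Metric.diam (Λ : Set Γ))] with n hn
  exact (lt_of_le_of_lt (iInf₂_le Λ hn) hΛ).ne

end SpinLattice

theorem mainTheorem4
    -- a lattice: a uniformly discrete metric space, isometrically embedded in `ℝ^D` with some norm
    {E : Type*} [NormedAddCommGroup E] [NormedSpace ℝ E] [FiniteDimensional ℝ E]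
    {Γ : Type*} [MetricSpace Γ] [DecidableEq Γ] (ι : Γ → E) (hι : Isometry ι)
    (ρ : ℝ) (hρ : 0 < ρ) (hsep : ∀ x y : Γ, x ≠ y → ρ ≤ dist x y)
    -- a finite range, frustration free local Hamiltonian made of projections
    {d : ℕ} (h : SpinLattice.Interaction Γ d) (hh : SpinLattice.IsAdmissible h)
    (hgapless : SpinLattice.IsGapless h) (ε : ℝ) (hε : 0 < ε) :
    (∀ᶠ n : ℝ in atTop, SpinLattice.gapAtScale h n ≠ ∞) ∧
      (fun n : ℝ => (SpinLattice.gapAtScale h n).toReal) =o[atTop]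
        (fun n : ℝ => Real.log n ^ (2 + ε) / n) := by
  refine ⟨SpinLattice.eventually_gapAtScale_ne_top hgapless, ?_⟩
  obtain ⟨K, hK⟩ := hh.exists_gapAtScale_le hι hρ hsep hgapless
  have h1 : (fun n : ℝ => (SpinLattice.gapAtScale h n).toReal) =O[atTop] fun n : ℝ => 1 * n⁻¹ := by
    refine IsBigO.of_bound |K| ?_
    filter_upwards [hK, eventually_gt_atTop 0] with n hn hn0
    rw [Real.norm_of_nonneg ENNReal.toReal_nonneg, one_mul, norm_inv, Real.norm_eq_abs,
      abs_of_pos hn0]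
    refine (ENNReal.toReal_le_of_le_ofReal (by positivity) (hn.trans
      (ENNReal.ofReal_le_ofReal ?_)))
    rw [div_eq_mul_inv]
    exact mul_le_mul_of_nonneg_right (le_abs_self K) (by positivity)
  have h2 : (fun _ : ℝ => (1 : ℝ)) =o[atTop] fun n : ℝ => Real.log n ^ (2 + ε) :=
    (isLittleO_one_left_iff ℝ).2 (tendsto_norm_atTop_atTop.comp
      ((tendsto_rpow_atTop (by linarith)).comp Real.tendsto_log_atTop))
  exact h1.trans_isLittleO (h2.mul_isBigO (isBigO_refl _ _))
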